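/- **Theorem 3.1.** Let $K$ be a compact connected Lie group of dimension $n$ with Lie algebra $\mathfrak K$, let $(\cdot,\cdot)$ be an $\mathrm{Ad}$-invariant inner product on $\mathfrak K$ and $X_1,\dots,X_n$ an orthonormal basis. Let $K_{\mathbb C}$ be the complexification of $K$; it is realized, through a smooth faithful unitary representation $K\to U(N)$ (one exists for every compact $K$), as $K_{\mathbb C}=\{xe^{iY}: x\in K,\ Y\in\mathfrak K\}\subset GL(N,\mathbb C)$. Identify $T^*K$ with $K\times\mathfrak K$ by left translations and the inner product. Let $\omega=-d\theta$, with $\theta_{(x,Y)}=\sum_i y^i w^i$, be its canonical symplectic form, where $w^i$ are the left-invariant one-forms dual to $X_i$ and $Y=\sum_i y^iX_i$; let $\epsilon=\omega^n/n!$, with Liouville measure $dx\,dY$, where $dx$ is a Haar measure on $K$. (One may normalize the inner product so that its Riemannian measure is the normalized Haar measure; the result does not depend on this.) For $s>0$ let $\psi_s:T^*K\to K_{\mathbb C}$, $\psi_s(x,Y)=xe^{isY}$, and let $J_s$ be the complex structure on $T^*K$ pulled back along $\psi_s$. Let $\tilde\eta_s^j$ ($1\le j\le n$) be the $J_s$-holomorphic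 one-forms obtained by pulling back along $\psi_s$ the left-invariant holomorphic one-forms of $K_{\mathbb C}$ dual to $X_1,\dots,X_n$, let $\Omega_s=\tilde\eta^1_s\wedge\dots\wedge\tilde\eta^n_s$, $b=(2i)^n(-1)^{n(n-1)/2}$, and let $|\Omega_s|\ge0$ be defined by $\overline{\Omega_s}\wedge\Omega_s=|\Omega_s|^2\,b\,\epsilon$. * The prequantum Hilbert space $\mathcal H^{prQ}_s$ consists of the sections $f\sqrt{\Omega_s}$ with $\int_{T^*K}|f|^2|\Omega_s|\,\epsilon<\infty$, and $\langle f\sqrt{\Omega_s},f'\sqrt{\Omega_s}\rangle^{prQ}=\int_{T^*K}\bar f f'\,|\Omega_s|\,\epsilon$. The bundle $\mathcal H^{prQ}\to\mathbb R_+$ has the smooth structure and the connection $\delta^{prQ}$ that the global trivialization $(g,s)\mapsto \frac{g}{\sqrt{|\Omega_s|}}\sqrt{\Omega_s}$, $g\in L^2(T^*K,\epsilon)$, carries over from the trivial bundle with the trivial connection. * Fix $\hbar_0>0$. The quantum Hilbert space $\mathcal H^{Q}_s\subset\mathcal H^{prQ}_s$ is the closed subspace of the sections $Fe^{-s|Y|^2/(2\hbar_0)}\sqrt{\Omega_s}$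 of finite norm with $F$ a $J_s$-holomorphic function. With $P$ the fiberwise orthogonal projection $\mathcal H^{prQ}\to\mathcal H^Q$, the quantum connection is $\delta^Q=P\circ\delta^{prQ}$. * For $s,s'>0$ the BKS pairing of $\sigma_s=f\sqrt{\Omega_s}$ and $\sigma'_{s'}=f'\sqrt{\Omega_{s'}}$ is $$\langle\sigma_s,\sigma'_{s'}\rangle^{BKS}=\int_{T^*K}\bar f f'\sqrt{\frac{\overline{\Omega_s}\wedge\Omega_{s'}}{b\,\epsilon}}\ \epsilon .$$ * The connection $\delta^{BKS}$ on $\mathcal H^Q$ is defined by the requirement that $\delta^{BKS}_{\partial/\partial s}\sigma'_s\in\mathcal H^Q_s$ and, for all $\tau\in\mathcal H^Q_s$, $$\big\langle\tau,\delta^{BKS}_{\partial/\partial s}\sigma'_s\big\rangle=\frac{\partial}{\partial s'}\Big|_{s'=s}\langle\tau,\sigma'_{s'}\rangle^{BKS}.$$ Then $\delta^{BKS}$ and $\delta^Q$ coincide: for every section $\sigma'$ of $\mathcal H^Q$ and every $s>0$ at which $\sigma'$ is differentiable as a section of $\mathcal H^{prQ}$ (in particular for all smooth sections and all $s>0$),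 the derivatives on the right exist for all $\tau\in\mathcal H^Q_s$, and the one and only vector $\delta^{BKS}_{\partial/\partial s}\sigma'_s$ that they define is $\delta^Q_{\partial/\partial s}\sigma'_s=P\big(\delta^{prQ}_{\partial/\partial s}\sigma'_s\big)$. -/

import Mathlib

open MeasureTheory
open scoped Manifold ContDiff ENNReal

attribute [instance 2000] chartedSpaceSelf

/-! ### Setting

`K` is a compact connected Lie group modelled on the finite dimensional inner product space `E`.
Since the tangent space of `K` at `1` is the model space, the Lie algebra of `K` is `E`, and the
fixed inner product on the Lie algebra is the inner product of `E`. Its Lie bracket is that of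
`GroupLieAlgebra 𝓘(ℝ, E) K`. The cotangent bundle of `K` is identified with `K × E` through left
translations and the inner product, and the tangent space of `K × E` at `p` is identified with
`E × E` through left translations: `(u, a)` stands for the vector whose first component is the
value at `p.1` of the left-invariant vector field of `u` and whose second component is `a`. -/

/-- The complex matrix algebra in which the complexified group is realized. -/
abbrev Mat (N : ℕ) : Type := EuclideanSpace ℂ (Fin N) →L[ℂ] EuclideanSpace ℂ (Fin N)

noncomputable section

section LieGroupPart

variable {n N : ℕ}
  {E : Type*} [NormedAddCommGroup E] [InnerProductSpace ℝ E]
  {K : Type*} [Group K] [TopologicalSpace K] [ChartedSpace E K]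

/-- The adjoint action of `x` on the Lie algebra. -/
def adjointAction (x : K) (u : E) : E :=
  mfderiv 𝓘(ℝ, E) 𝓘(ℝ, E) (fun y : K => x * y * x⁻¹) (1 : K) u

/-- The inner product of the Lie algebra is `Ad`-invariant. -/
def IsAdInvariant (K : Type*) {E : Type*} [NormedAddCommGroup E] [InnerProductSpace ℝ E]
    [Group K] [TopologicalSpace K] [ChartedSpace E K] : Prop :=
  ∀ (x : K) (u v : E), inner ℝ (adjointAction x u) (adjointAction x v) = inner ℝ u v

/-- The derivative of a function on `K × E` at `p` in the direction `(u, a)`. -/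
def dirDeriv {M : Type*} [NormedAddCommGroup M] [NormedSpace ℝ M]
    (f : K × E → M) (p : K × E) (t : E × E) : M :=
  mfderiv (𝓘(ℝ, E).prod 𝓘(ℝ, E)) 𝓘(ℝ, M) f p
    ((mulInvariantVectorField (I := 𝓘(ℝ, E)) (G := K) t.1 p.1, t.2) : E × E)

/-- The canonical symplectic form `ω = -dθ`, where `θ` at `(x, Y)` takes `(u, a)` to `⟪Y, u⟫`.
With `dθ(U, V) = U(θ V) - V(θ U) - θ [U, V]` for the fields `U`, `V` with constant components
`(u, a)`, `(v, b)`, this is `⟪u, b⟫ - ⟪a, v⟫ + ⟪Y, [u, v]⟫`. -/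
def symplecticForm (p : K × E) (t t' : E × E) : ℝ :=
  let u : GroupLieAlgebra 𝓘(ℝ, E) K := t.1
  let v : GroupLieAlgebra 𝓘(ℝ, E) K := t'.1
  let uv : GroupLieAlgebra 𝓘(ℝ, E) K := ⁅u, v⁆
  inner ℝ t.1 t'.2 - inner ℝ t.2 t'.1 + inner ℝ p.2 (show E from uv)

/-- The ordered index set `1, …, n, n+1, …, 2n` (written `Fin n ⊕ Fin n`) cut into the `n`
consecutive pairs `(1, 2), (3, 4), …, (2n-1, 2n)`. -/
def consecutivePairs (n : ℕ) : Fin n × Fin 2 ≃ Fin n ⊕ Fin n :=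
  finProdFinEquiv.trans ((finCongr (Nat.mul_two n)).trans finSumFinEquiv.symm)

/-- The Liouville volume form `ε = ωⁿ / n!` at `p`, evaluated on `2n` vectors:
`(2ⁿ n!)⁻¹ ∑_σ sgn σ ∏_i ω(v_σ(2i-1), v_σ(2i))`. -/
def liouvilleForm (p : K × E) (v : Fin n ⊕ Fin n → E × E) : ℝ :=
  ((2 : ℝ) ^ n * (n.factorial : ℝ))⁻¹ *
    ∑ τ : Equiv.Perm (Fin n ⊕ Fin n), ((Equiv.Perm.sign τ : ℤ) : ℝ) *
      ∏ i : Fin n, symplecticForm p (v (τ (consecutivePairs n (i, 0))))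
        (v (τ (consecutivePairs n (i, 1))))

/-- The left-invariant frame `X₁, …, Xₙ, ∂/∂y¹, …, ∂/∂yⁿ` of the cotangent bundle. -/
def cotangentFrame (X : OrthonormalBasis (Fin n) ℝ E) : Fin n ⊕ Fin n → E × E :=
  Sum.elim (fun j => (X j, 0)) (fun j => (0, X j))

/-- The derivative at the identity of a unitary representation. -/
def repDeriv (ρ : K →* unitary (Mat N)) (u : E) : Mat N :=
  mfderiv 𝓘(ℝ, E) 𝓘(ℝ, Mat N) (fun x : K => (ρ x : Mat N)) (1 : K) u

/-- The map `ψ_s(x, Y) = x e^{isY}`. When `ρ` is faithful (every compact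
Lie group has such a `ρ`), `K` is identified with `ρ(K)`, its Lie algebra with the image of
`repDeriv ρ`, and the complexification of `K` is the complex subgroup `{ρ(x) e^{i dρ(Y)}}` of
`GL(N, ℂ)`, whose Lie algebra is the complex span of the image of `repDeriv ρ`. Up to isomorphism
of complex Lie groups over `K` it does not depend on `ρ`. -/
def psi (ρ : K →* unitary (Mat N)) (s : ℝ) (p : K × E) : Mat N :=
  (ρ p.1 : Mat N) * NormedSpace.exp ((Complex.I * (s : ℂ)) • repDeriv ρ p.2)

/-- The derivative of `ψ_s` at `p`, translated back to the identity of the complexified group: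
`t ↦ ψ_s(p)⁻¹ dψ_s(t)`. -/
def psiLogDeriv (ρ : K →* unitary (Mat N)) (s : ℝ) (p : K × E) (t : E × E) : Mat N :=
  Ring.inverse (psi ρ s p) * dirDeriv (psi ρ s) p t

/-- The complex structure `J_s` on the cotangent bundle, pulled back along `ψ_s`:
`dψ_s(J_s t) = i dψ_s(t)`. -/
def complexStructure (ρ : K →* unitary (Mat N)) (s : ℝ) (p : K × E) (t : E × E) : E × E :=
  Function.invFun (psiLogDeriv ρ s p) (Complex.I • psiLogDeriv ρ s p t)

/-- The left-invariant `J_s`-holomorphic one-forms `η_s¹, …, η_sⁿ`: the pull-backs under `ψ_s` of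
the left-invariant holomorphic one-forms of the complexified group that are dual to the basis
`X₁, …, Xₙ` of its complex Lie algebra, that is `ψ_s⁻¹ dψ_s(t) = ∑ⱼ η_sʲ(t) Xⱼ`. In other words,
`η_sʲ` is complex linear for `J_s`, and it takes the value `δʲₖ` on the vector field that `ψ_s`
maps to the left-invariant field `Xₖ` of the complexified group. -/
def holForm (X : OrthonormalBasis (Fin n) ℝ E) (ρ : K →* unitary (Mat N)) (s : ℝ)
    (p : K × E) (j : Fin n) (t : E × E) : ℂ :=
  Function.invFun (fun c : Fin n → ℂ => ∑ k, c k • repDeriv ρ (X k)) (psiLogDeriv ρ s p t) j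

/-- The wedge product of one-forms: `(α₁ ∧ … ∧ α_m)(v₁, …, v_m) = det (α_i(v_j))`. -/
def wedge {ι T : Type*} [Fintype ι] [DecidableEq ι] (α : ι → T → ℂ) (v : ι → T) : ℂ :=
  Matrix.det (Matrix.of fun i j => α i (v j))

/-- The form `conj Ω_s ∧ Ω_s'` of top degree, where `Ω_s = η_s¹ ∧ … ∧ η_sⁿ`. -/
def OmegaBarWedgeOmega (X : OrthonormalBasis (Fin n) ℝ E) (ρ : K →* unitary (Mat N))
    (s s' : ℝ) (p : K × E) (v : Fin n ⊕ Fin n → E × E) : ℂ :=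
  wedge (Sum.elim (fun j t => starRingEnd ℂ (holForm X ρ s p j t)) (holForm X ρ s' p)) v

/-- The quotient `(conj Ω_s ∧ Ω_s') / (b ε)` of two forms of top degree, where
`b = (2i)ⁿ (-1)^{n(n-1)/2}`. -/
def OmegaRatio (X : OrthonormalBasis (Fin n) ℝ E) (ρ : K →* unitary (Mat N))
    (s s' : ℝ) (p : K × E) : ℂ :=
  OmegaBarWedgeOmega X ρ s s' p (cotangentFrame X) /
    (((2 * Complex.I) ^ n * (-1) ^ (n * (n - 1) / 2)) *
      ((liouvilleForm p (cotangentFrame X) : ℝ) : ℂ))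

/-- The norm `|Ω_s|`, with `conj Ω_s ∧ Ω_s = |Ω_s|² b ε`. -/
def OmegaNorm (X : OrthonormalBasis (Fin n) ℝ E) (ρ : K →* unitary (Mat N))
    (s : ℝ) (p : K × E) : ℝ :=
  √(OmegaRatio X ρ s s p).re

/-- `J_s`-holomorphic functions: smooth functions `F` with `dF ∘ J_s = i dF`. -/
def IsJHolomorphic (ρ : K →* unitary (Mat N)) (s : ℝ) (F : K × E → ℂ) : Prop :=
  ContMDiff (𝓘(ℝ, E).prod 𝓘(ℝ, E)) 𝓘(ℝ, ℂ) ∞ F ∧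
    ∀ (p : K × E) (t : E × E),
      dirDeriv F p (complexStructure ρ s p t) = Complex.I * dirDeriv F p t

end LieGroupPart

section HilbertBundles

variable {n N : ℕ}
  {E : Type*} [NormedAddCommGroup E] [InnerProductSpace ℝ E] [FiniteDimensional ℝ E]
  [MeasurableSpace E] [BorelSpace E]
  {K : Type*} [Group K] [TopologicalSpace K] [ChartedSpace E K] [MeasurableSpace K]
  (X : OrthonormalBasis (Fin n) ℝ E) (ρ : K →* unitary (Mat N)) (μ : Measure K)

/-- The measure of the volume form `ε`: in the frame `X₁, …, Xₙ, ∂/∂y¹, …, ∂/∂yⁿ` it is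
`|ε(X₁, …, ∂/∂yⁿ)| dx dY`, where `dx` is the invariant measure `μ` on `K` and `dY` is Lebesgue
measure on the Lie algebra. -/
def liouvilleMeasure : Measure (K × E) :=
  (μ.prod volume).withDensity fun p => ENNReal.ofReal |liouvilleForm p (cotangentFrame X)|

/-- The measure `|Ω_s| ε`. -/
def fiberMeasure (s : ℝ) : Measure (K × E) :=
  (liouvilleMeasure X μ).withDensity fun p => ENNReal.ofReal (OmegaNorm X ρ s p)

/-- The prequantum Hilbert space over `s`. The section `f √Ω_s` is represented by its coefficient
`f`, and the Hermitian structure is `⟨f √Ω_s, f' √Ω_s⟩ = ∫ conj f f' |Ω_s| ε`. -/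
abbrev PrequantumFiber (s : ℝ) : Type _ := Lp ℂ 2 (fiberMeasure X ρ μ s)

variable {X μ} in
/-- The polarized sections `F e^{-s|Y|²/(2ħ)} √Ω_s` of finite norm, with `F` a `J_s`-holomorphic
function. -/
def polarizedSections (ħ s : ℝ) : Set (PrequantumFiber X ρ μ s) :=
  {σ | ∃ F : K × E → ℂ, IsJHolomorphic ρ s F ∧
    ⇑σ =ᵐ[fiberMeasure X ρ μ s]
      fun p => F p * ((Real.exp (-(s * ‖p.2‖ ^ 2) / (2 * ħ)) : ℝ) : ℂ)}

/-- The quantum Hilbert space over `s`: the Hilbert subspace of the polarized sections (they form a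
linear subspace, which is closed since `L²` limits of holomorphic functions are holomorphic; so
neither the span nor the closure adds anything). -/
def quantumFiber (ħ s : ℝ) : Submodule ℂ (PrequantumFiber X ρ μ s) :=
  (Submodule.span ℂ (polarizedSections ρ ħ s)).topologicalClosure

variable {X ρ μ}

instance (ħ s : ℝ) : CompleteSpace (quantumFiber X ρ μ ħ s) :=
  (Submodule.isClosed_topologicalClosure _).completeSpace_coe

open Classical in
/-- The global trivialization `L²(ε) → ℋ_s`, `g ↦ (g / √|Ω_s|) √Ω_s`. -/
def trivialize (s : ℝ) (g : Lp ℂ 2 (liouvilleMeasure X μ)) : PrequantumFiber X ρ μ s :=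
  if h : MemLp (fun p => g p / ((√(OmegaNorm X ρ s p) : ℝ) : ℂ)) 2 (fiberMeasure X ρ μ s)
  then h.toLp _ else 0

open Classical in
/-- The inverse `f √Ω_s ↦ f √|Ω_s|` of the global trivialization. -/
def untrivialize (s : ℝ) (σ : PrequantumFiber X ρ μ s) : Lp ℂ 2 (liouvilleMeasure X μ) :=
  if h : MemLp (fun p => σ p * ((√(OmegaNorm X ρ s p) : ℝ) : ℂ)) 2 (liouvilleMeasure X μ)
  then h.toLp _ else 0

/-- A section of the prequantum bundle is differentiable at `s` if it is so in the global
trivialization. -/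
def SectionDifferentiableAt (σ : ∀ s : ℝ, PrequantumFiber X ρ μ s) (s : ℝ) : Prop :=
  DifferentiableAt ℝ (fun r => untrivialize r (σ r)) s

/-- The prequantum connection `δ^prQ`, applied to the direction `∂/∂s`: the connection which the
global trivialization carries over from the trivial connection. -/
def prequantumConnection (σ : ∀ s : ℝ, PrequantumFiber X ρ μ s) (s : ℝ) :
    PrequantumFiber X ρ μ s :=
  trivialize s (deriv (fun r => untrivialize r (σ r)) s)

/-- The quantum connection `δ^Q = P ∘ δ^prQ`, where `P` is the orthogonal projection to the
quantum bundle. -/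
def quantumConnection (ħ : ℝ) (σ : ∀ s : ℝ, PrequantumFiber X ρ μ s) (s : ℝ) :
    PrequantumFiber X ρ μ s :=
  (quantumFiber X ρ μ ħ s).starProjection (prequantumConnection σ s)

/-- The BKS pairing
`⟨f √Ω_s, f' √Ω_s'⟩ = ∫ conj f f' √((conj Ω_s ∧ Ω_s') / (b ε)) ε` between two fibers. -/
def bksPairing {s s' : ℝ} (σ : PrequantumFiber X ρ μ s) (σ' : PrequantumFiber X ρ μ s') : ℂ :=
  ∫ p, starRingEnd ℂ (σ p) * σ' p * (OmegaRatio X ρ s s' p) ^ (1 / 2 : ℂ) ∂(liouvilleMeasure X μ)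

/-- `D` is the value at `s` of `δ^BKS` applied to the section `σ` of the quantum bundle and the
direction `∂/∂s`: it is the vector of the quantum fiber for which
`⟨τ, D⟩ = ∂/∂s' ⟨τ, σ_s'⟩^BKS` at `s' = s`, for all `τ` in the quantum fiber over `s`. -/
def IsBKSConnectionValue (ħ : ℝ) (σ : ∀ s : ℝ, PrequantumFiber X ρ μ s) (s : ℝ)
    (D : PrequantumFiber X ρ μ s) : Prop :=
  D ∈ quantumFiber X ρ μ ħ s ∧
    ∀ τ ∈ quantumFiber X ρ μ ħ s,
      HasDerivAt (fun s' : ℝ => bksPairing τ (σ s')) (inner ℂ τ D) s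

end HilbertBundles

end

/-! In the global trivialization `δ^prQ` is plain differentiation, and the BKS pairing between the
fibers over `s` and `s'` is an `L²(ε)` pairing with an extra kernel `κ = √((conj Ω_s ∧ Ω_s') / (b
ε)) / √(|Ω_s| |Ω_s'|)`. The theorem comes down to `κ = 1 + O((s' - s)²)` uniformly on the noncompact
space `K × E` (`norm_bksPairing_sub_inner_le`). Then the derivative of the pairing at `s' = s` is
`⟨τ, δ^prQ σ⟩` (`hasDerivAt_bksPairing`), and the vector of the quantum fiber that represents this
functional there is the orthogonal projection of `δ^prQ σ`.

The kernel is explicit. Invariance of the inner product makes `ad Y` real and skew, so `i ad Y` is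
Hermitian and traceless, with real eigenvalues `l` of sum zero. In an eigenbasis the two halves of
`ψ_s⁻¹ dψ_s` are multiplication by `e^{-sl}` and by `i (1 - e^{-sl}) / l`, and the top-degree form
splits into 2×2 determinants `2i e^{(s-s')l/2} sinh((s+s')l/2) / l`. The exponentials multiply to
one, so the quotient of forms is `∏ sinh((s+s')l/2) / l` (`exists_OmegaRatio_eq`): a function `m` of
the midpoint alone.

Hence `κ⁴ = m((s+s')/2)² / (m(s) m(s'))`, which differs from one only to second order. Uniformity in
`l` comes from `sinh²((a+b)/2) = sinh a sinh b + sinh²((a-b)/2)` and the convexity of `sinh`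
(`sinhQuot_midpoint`). -/

noncomputable section

/-! ### The differential of a faithful unitary representation -/

section Representation

variable {N : ℕ}
  {E : Type*} [NormedAddCommGroup E] [InnerProductSpace ℝ E]
  {K : Type*} [Group K] [TopologicalSpace K] [ChartedSpace E K]

/-- The derivative at the identity of a representation, as a linear map. -/
def repDerivLM (ρ : K →* unitary (Mat N)) : E →ₗ[ℝ] Mat N where
  toFun := repDeriv ρ
  map_add' u v := by
    unfold repDeriv
    exact map_add (mfderiv 𝓘(ℝ, E) 𝓘(ℝ, Mat N) (fun x : K => (ρ x : Mat N)) (1 : K)) u v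
  map_smul' c u := by
    unfold repDeriv
    exact map_smul (mfderiv 𝓘(ℝ, E) 𝓘(ℝ, Mat N) (fun x : K => (ρ x : Mat N)) (1 : K)) c u

@[simp] theorem repDerivLM_apply (ρ : K →* unitary (Mat N)) (u : E) :
    repDerivLM ρ u = repDeriv ρ u := rfl

variable [LieGroup 𝓘(ℝ, E) ∞ K]

theorem mfderiv_rep_mulInvariantVectorField {ρ : K →* unitary (Mat N)}
    (hρ : ContMDiff 𝓘(ℝ, E) 𝓘(ℝ, Mat N) ∞ fun x : K => (ρ x : Mat N)) (x : K) (u : E) :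
    (mfderiv 𝓘(ℝ, E) 𝓘(ℝ, Mat N) (fun x : K => (ρ x : Mat N)) x
      (mulInvariantVectorField (I := 𝓘(ℝ, E)) (G := K) u x) : Mat N) = (ρ x : Mat N) * repDeriv ρ u := by
  have hd : ∀ y, MDifferentiableAt 𝓘(ℝ, E) 𝓘(ℝ, Mat N) (fun x : K => (ρ x : Mat N)) y :=
    fun y => (hρ y).mdifferentiableAt (by simp)
  have hl : MDifferentiableAt 𝓘(ℝ, E) 𝓘(ℝ, E) (fun y : K => x * y) 1 :=
    (contMDiff_mul_left (I := 𝓘(ℝ, E)) (n := ∞) (a := x) (1 : K)).mdifferentiableAt (by simp)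
  have h1 : HasMFDerivAt 𝓘(ℝ, E) 𝓘(ℝ, Mat N) (fun y : K => (ρ (x * y) : Mat N)) 1 _ :=
    HasMFDerivAt.comp (g := fun x : K => (ρ x : Mat N)) (f := fun y : K => x * y) (1 : K) (hd (x * 1)).hasMFDerivAt hl.hasMFDerivAt
  have h2 : HasMFDerivAt 𝓘(ℝ, E) 𝓘(ℝ, Mat N) (fun y : K => (ρ x : Mat N) * (ρ y : Mat N)) 1 _ :=
    HasMFDerivAt.comp (1 : K)
      ((ContinuousLinearMap.mul ℝ (Mat N) (ρ x : Mat N)).hasMFDerivAt) (hd 1).hasMFDerivAt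
  have h3 : (fun y : K => (ρ (x * y) : Mat N)) = fun y : K => (ρ x : Mat N) * (ρ y : Mat N) := by
    ext1 y; simp
  rw [h3] at h1
  have := congrArg (fun L => L u) (hasMFDerivAt_unique h1 h2)
  have h4 : x * 1 = x := mul_one x
  rw [h4] at this
  exact this

theorem repDeriv_adjointAction {ρ : K →* unitary (Mat N)}
    (hρ : ContMDiff 𝓘(ℝ, E) 𝓘(ℝ, Mat N) ∞ fun x : K => (ρ x : Mat N)) (x : K) (u : E) :
    repDeriv ρ (adjointAction x u) = ρ x * repDeriv ρ u * star (ρ x : Mat N) := by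
  have hd : ∀ y, MDifferentiableAt 𝓘(ℝ, E) 𝓘(ℝ, Mat N) (fun x : K => (ρ x : Mat N)) y :=
    fun y => (hρ y).mdifferentiableAt (by simp)
  have hl : MDifferentiableAt 𝓘(ℝ, E) 𝓘(ℝ, E) (fun y : K => x * y * x⁻¹) 1 :=
    ((contMDiff_mul_right (I := 𝓘(ℝ, E)) (n := ∞) (a := x⁻¹)).comp
      (contMDiff_mul_left (I := 𝓘(ℝ, E)) (n := ∞) (a := x)) (1 : K)).mdifferentiableAt (by simp)
  have h1 : HasMFDerivAt 𝓘(ℝ, E) 𝓘(ℝ, Mat N) (fun y : K => (ρ (x * y * x⁻¹) : Mat N)) 1 _ :=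
    HasMFDerivAt.comp (g := fun x : K => (ρ x : Mat N)) (f := fun y : K => x * y * x⁻¹) (1 : K) (hd (x * 1 * x⁻¹)).hasMFDerivAt hl.hasMFDerivAt
  have h2 : HasMFDerivAt 𝓘(ℝ, E) 𝓘(ℝ, Mat N)
      (fun y : K => (ρ x : Mat N) * (ρ y : Mat N) * star (ρ x : Mat N)) 1 _ :=
    HasMFDerivAt.comp (1 : K)
      (((ContinuousLinearMap.mul ℝ (Mat N)).flip (star (ρ x : Mat N))).comp
        (ContinuousLinearMap.mul ℝ (Mat N) (ρ x : Mat N))).hasMFDerivAt (hd 1).hasMFDerivAt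
  have h3 : (fun y : K => (ρ (x * y * x⁻¹) : Mat N)) =
      fun y : K => (ρ x : Mat N) * (ρ y : Mat N) * star (ρ x : Mat N) := by
    ext1 y
    rw [map_mul, map_mul, map_inv, ← Unitary.star_eq_inv]
    rfl
  rw [h3] at h1
  have := congrArg (fun L => L u) (hasMFDerivAt_unique h1 h2)
  have h4 : x * 1 * x⁻¹ = 1 := by simp
  rw [h4] at this
  exact this

variable [CompleteSpace E]

/-- The integral curve of a left-invariant field through the identity, and the derivative of a
representation along it. -/
theorem exists_curve {ρ : K →* unitary (Mat N)}
    (hρ : ContMDiff 𝓘(ℝ, E) 𝓘(ℝ, Mat N) ∞ fun x : K => (ρ x : Mat N)) (u : E) :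
    ∃ γ : ℝ → K, γ 0 = 1 ∧
      IsMIntegralCurveAt (I := 𝓘(ℝ, E)) γ
        (fun x => mulInvariantVectorField (I := 𝓘(ℝ, E)) (G := K) u x) 0 ∧
      ∀ᶠ t in nhds 0, HasDerivAt (fun t => (ρ (γ t) : Mat N)) ((ρ (γ t) : Mat N) * repDeriv ρ u) t := by
  have : LieGroup 𝓘(ℝ, E) (minSmoothness ℝ 3) K := by
    rw [minSmoothness_of_isRCLikeNormedField]
    infer_instance
  have : IsManifold 𝓘(ℝ, E) 1 K := IsManifold.of_le (n := ∞) (by exact_mod_cast (le_top : ((1 : ℕ∞)) ≤ ⊤))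
  have hv := contMDiffAt_mulInvariantVectorField (I := 𝓘(ℝ, E)) (G := K) u (g := 1)
  obtain ⟨γ, h0, hγ⟩ := exists_isMIntegralCurveAt_of_contMDiffAt_boundaryless
    (I := 𝓘(ℝ, E)) (M := K)
    (v := fun x => mulInvariantVectorField (I := 𝓘(ℝ, E)) (G := K) u x) (t₀ := 0)
    (hv.of_le (by
      simp only [minSmoothness_of_isRCLikeNormedField]
      exact_mod_cast (by norm_num : (1 : ℕ) ≤ 2)))
  refine ⟨γ, h0, hγ, ?_⟩
  filter_upwards [hγ] with t ht
  have h1 := HasMFDerivAt.comp t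
    (((hρ (γ t)).mdifferentiableAt (by simp)).hasMFDerivAt) ht
  have h2 : HasFDerivAt (fun t => (ρ (γ t) : Mat N)) (_ : ℝ →L[ℝ] Mat N) t :=
    hasMFDerivAt_iff_hasFDerivAt.1 h1
  have h2 := h2.hasDerivAt
  refine h2.congr_deriv ?_
  rw [← mfderiv_rep_mulInvariantVectorField hρ]
  change mfderiv 𝓘(ℝ, E) 𝓘(ℝ, Mat N) (fun x : K => (ρ x : Mat N)) (γ t)
    ((1:ℝ) • (mulInvariantVectorField (I := 𝓘(ℝ, E)) (G := K) u (γ t))) = _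
  rw [one_smul]

/-- If `dρ(u) = 0`, then `ρ` is constant along the integral curve of `u`; by faithfulness the curve
itself is constant near `0`, so its velocity `u` vanishes. -/
theorem repDeriv_injective {ρ : K →* unitary (Mat N)} (hinj : Function.Injective ρ)
    (hρ : ContMDiff 𝓘(ℝ, E) 𝓘(ℝ, Mat N) ∞ fun x : K => (ρ x : Mat N)) :
    Function.Injective (repDeriv (E := E) ρ) := by
  refine (injective_iff_map_eq_zero (repDerivLM ρ)).2 fun u hu => ?_
  obtain ⟨γ, h0, hγ, hd⟩ := exists_curve hρ u
  rw [repDerivLM_apply] at hu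
  simp only [hu, mul_zero] at hd
  obtain ⟨ε, hε, hball⟩ := Metric.eventually_nhds_iff_ball.1 hd
  have hconst : ∀ t ∈ Metric.ball (0 : ℝ) ε, γ t = 1 := by
    intro t ht
    have := Convex.is_const_of_fderivWithin_eq_zero (𝕜 := ℝ)
      (f := fun t => (ρ (γ t) : Mat N)) (convex_ball (0 : ℝ) ε)
      (fun x hx => (hball x hx).differentiableAt.differentiableWithinAt)
      (fun x hx => by
        rw [fderivWithin_of_isOpen Metric.isOpen_ball hx]
        ext1
        simp [(hball x hx).hasFDerivAt.fderiv])
      ht (Metric.mem_ball_self hε)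
    rw [← h0]
    exact hinj (Subtype.ext this)
  have hev : γ =ᶠ[nhds 0] fun _ => (1 : K) :=
    Metric.eventually_nhds_iff_ball.2 ⟨ε, hε, hconst⟩
  have h1 := hγ.self_of_nhds
  have h2 : HasMFDerivAt 𝓘(ℝ, ℝ) 𝓘(ℝ, E) γ 0 0 :=
    (hasMFDerivAt_const (I := 𝓘(ℝ, ℝ)) (I' := 𝓘(ℝ, E)) (1 : K) (0 : ℝ)).congr_of_eventuallyEq hev
  have h3 := congrArg (fun L => L (1 : ℝ)) (hasMFDerivAt_unique h1 h2)
  have h4 : (1 : ℝ) • mulInvariantVectorField (I := 𝓘(ℝ, E)) (G := K) u (γ 0) = 0 := h3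
  rw [one_smul, h0] at h4
  have h5 : mulInvariantVectorField (I := 𝓘(ℝ, E)) (G := K) u 1 = u := by
    change mfderiv 𝓘(ℝ, E) 𝓘(ℝ, E) (fun x : K => 1 * x) 1 u = u
    have h6 : (fun x : K => 1 * x) = id := by ext1 x; exact one_mul x
    rw [h6]
    exact congrArg (fun L => L u) (mfderiv_id (I := 𝓘(ℝ, E)) (M := K) (x := 1))
  rw [h5] at h4
  exact h4

/-- Differentiate `ρ ρ* = 1` along the integral curve of `u`. -/
theorem star_repDeriv {ρ : K →* unitary (Mat N)}
    (hρ : ContMDiff 𝓘(ℝ, E) 𝓘(ℝ, Mat N) ∞ fun x : K => (ρ x : Mat N)) (u : E) :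
    star (repDeriv ρ u) = - repDeriv ρ u := by
  obtain ⟨γ, h0, -, hd⟩ := exists_curve hρ u
  have h1 := hd.self_of_nhds
  simp only [h0, map_one, OneMemClass.coe_one, one_mul] at h1
  have h2 := h1.mul h1.star
  have h3 : (fun t => (ρ (γ t) : Mat N)) * (fun t => star (ρ (γ t) : Mat N)) = fun _ => 1 := by
    ext1 t
    simp
  rw [h3] at h2
  have := h2.unique (hasDerivAt_const (0 : ℝ) (1 : Mat N))
  simp only [h0, map_one, OneMemClass.coe_one, star_one, one_mul, mul_one] at this
  exact (neg_eq_of_add_eq_zero_right this).symm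

variable [FiniteDimensional ℝ E]

/-- The adjoint action of the Lie algebra, seen through a faithful representation, is by skew
endomorphisms for an invariant inner product. -/
theorem exists_skew_bracket (hAd : IsAdInvariant (E := E) K)
    {ρ : K →* unitary (Mat N)} (hinj : Function.Injective ρ)
    (hρ : ContMDiff 𝓘(ℝ, E) 𝓘(ℝ, Mat N) ∞ fun x : K => (ρ x : Mat N)) (Y : E) :
    ∃ B : E → E, (∀ u : E, repDeriv ρ (B u) = repDeriv ρ Y * repDeriv ρ u - repDeriv ρ u * repDeriv ρ Y)
      ∧ ∀ u v, inner ℝ (B u) v + inner ℝ u (B v) = 0 := by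
  -- Through the left inverse, `Ad(γ t) u = L (ρ(γ t) dρ(u) ρ(γ t)*)`, so differentiability of `t ↦
  -- Ad(γ t) u` follows from that of `ρ ∘ γ`.
  obtain ⟨L, hL⟩ := (repDerivLM (E := E) ρ).exists_leftInverse_of_injective
    (LinearMap.ker_eq_bot.2 (repDeriv_injective hinj hρ))
  have hL' : ∀ u : E, L (repDeriv ρ u) = u := fun u => congrArg (fun f => f u) hL
  let Lc : Mat N →L[ℝ] E := ⟨L, L.continuous_of_finiteDimensional⟩
  obtain ⟨γ, h0, -, hd⟩ := exists_curve hρ Y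
  have h1 := hd.self_of_nhds
  simp only [h0, map_one, OneMemClass.coe_one, one_mul] at h1
  have hc : ∀ u : E, HasDerivAt (fun t => (ρ (γ t) : Mat N) * repDeriv ρ u * star (ρ (γ t) : Mat N))
      (repDeriv ρ Y * repDeriv ρ u - repDeriv ρ u * repDeriv ρ Y) 0 := by
    intro u
    refine ((h1.mul_const (repDeriv ρ u)).mul h1.star).congr_deriv ?_
    simp [h0, star_repDeriv hρ, sub_eq_add_neg]
    exact mul_neg (repDeriv ρ u) (repDeriv ρ Y)
  have hAdd : ∀ u : E, HasDerivAt (fun t => adjointAction (E := E) (γ t) u)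
      (Lc (repDeriv ρ Y * repDeriv ρ u - repDeriv ρ u * repDeriv ρ Y)) 0 := by
    intro u
    have := Lc.hasFDerivAt.comp_hasDerivAt (0 : ℝ) (hc u)
    refine this.congr_of_eventuallyEq (Filter.Eventually.of_forall fun t => ?_)
    change _ = L ((ρ (γ t) : Mat N) * repDeriv ρ u * star (ρ (γ t) : Mat N))
    rw [← repDeriv_adjointAction hρ, hL']
  refine ⟨fun u => Lc (repDeriv ρ Y * repDeriv ρ u - repDeriv ρ u * repDeriv ρ Y), ?_, ?_⟩
  · intro u
    -- The commutator is a limit of difference quotients of `dρ(Ad(γ t) u)`, which lie in the closed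
    -- subspace `range dρ`. This avoids comparing it with the bracket of vector fields.
    have h2 : repDeriv ρ Y * repDeriv ρ u - repDeriv ρ u * repDeriv ρ Y ∈
        (LinearMap.range (repDerivLM (E := E) ρ)) := by
      have hcl : IsClosed ((LinearMap.range (repDerivLM (E := E) ρ) : Submodule ℝ (Mat N)) :
        Set (Mat N)) := Submodule.closed_of_finiteDimensional _
      have hslope := hasDerivAt_iff_tendsto_slope.1 (hc u)
      refine hcl.mem_of_tendsto hslope (Filter.Eventually.of_forall fun t => ?_)
      simp only [← repDeriv_adjointAction hρ, slope, vsub_eq_sub]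
      refine Submodule.smul_mem _ _ (Submodule.sub_mem _ ?_ ?_)
      · exact ⟨_, rfl⟩
      · exact ⟨_, rfl⟩
    obtain ⟨w, hw⟩ := h2
    change repDeriv ρ (L _) = _
    rw [← hw, repDerivLM_apply, hL']
  · intro u v
    -- Skewness is the derivative at `t = 0` of the constant `⟪Ad(γ t) u, Ad(γ t) v⟫`.
    have h2 := (hAdd u).inner ℝ (hAdd v)
    have h3 : (fun t => inner ℝ (adjointAction (E := E) (γ t) u) (adjointAction (E := E) (γ t) v)) =
        fun _ => inner ℝ u v := by
      ext1 t; exact hAd (γ t) u v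
    rw [h3] at h2
    have h4 := h2.unique (hasDerivAt_const (0 : ℝ) _)
    have h5 : ∀ w : E, adjointAction (1 : K) w = w := by
      intro w
      apply repDeriv_injective hinj hρ
      rw [repDeriv_adjointAction hρ]
      simp
    rw [h0, h5, h5, add_comm] at h4
    exact h4

end Representation

end

/-! ### The exponential and its derivative on eigenvectors of a commutator -/

section Exponential

variable {𝔸 : Type*} [NormedRing 𝔸] [NormedAlgebra ℂ 𝔸] [CompleteSpace 𝔸]

open NormedSpace (exp)

theorem differentiable_normedSpace_exp : Differentiable ℂ (exp : 𝔸 → 𝔸) := fun x =>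
  (NormedSpace.exp_analytic (𝕂 := ℂ) x).differentiableAt

theorem continuous_fderiv_normedSpace_exp : Continuous (fderiv ℂ (exp : 𝔸 → 𝔸)) := by
  have h : AnalyticOnNhd ℂ (exp : 𝔸 → 𝔸) Set.univ := fun x _ =>
    NormedSpace.exp_analytic (𝕂 := ℂ) x
  have h2 : ContDiff ℂ 1 (exp : 𝔸 → 𝔸) := contDiffOn_univ.1 (h.contDiffOn uniqueDiffOn_univ)
  exact h2.continuous_fderiv (by simp)

/-- Conjugation by the exponential, on an eigenvector of the commutator with `Z`. -/
theorem exp_neg_mul_mul_exp_of_commutator {Z W : 𝔸} {c : ℂ} (h : Z * W - W * Z = c • W) :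
    exp (-Z) * W * exp Z = Complex.exp (-c) • W := by
  have : NormedAlgebra ℚ 𝔸 := NormedAlgebra.restrictScalars ℚ ℂ 𝔸
  -- The eigenvector equation reads `W (Z + c) = Z W`; exponentiating gives `W e^{Z+c} = e^Z W`.
  have h1 : SemiconjBy W (Z + algebraMap ℂ 𝔸 c) Z := by
    rw [SemiconjBy, mul_add, ← Algebra.commutes, ← Algebra.smul_def, ← h]
    abel
  have h2 := h1.exp_right
  have h3 : exp (Z + algebraMap ℂ 𝔸 c) = Complex.exp c • exp Z := by
    rw [NormedSpace.exp_add_of_commute (Algebra.commutes c Z).symm,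
      ← NormedSpace.algebraMap_exp_comm (𝕂 := ℂ), ← Complex.exp_eq_exp_ℂ, ← Algebra.commutes,
      ← Algebra.smul_def]
  rw [SemiconjBy, h3, mul_smul_comm] at h2
  have h4 : W * exp Z = Complex.exp (-c) • (exp Z * W) := by
    rw [← h2, smul_smul, ← Complex.exp_add]; simp
  have h5 : exp (-Z) * exp Z = 1 := by
    rw [← NormedSpace.exp_add_of_commute (Commute.neg_left (Commute.refl Z))]; simp
  rw [mul_assoc, h4, mul_smul_comm, ← mul_assoc, h5, one_mul]

theorem hasDerivAt_exp_smul_zero (V : 𝔸) : HasDerivAt (fun t : ℂ => exp (t • V)) V 0 := by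
  have : NormedAlgebra ℚ 𝔸 := NormedAlgebra.restrictScalars ℚ ℂ 𝔸
  simpa using hasDerivAt_exp_smul_const (𝕂 := ℂ) V (0 : ℂ)

/-- The derivative of the exponential in the direction of a commutator. -/
theorem fderiv_exp_commutator (Z V : 𝔸) :
    fderiv ℂ exp Z (Z * V - V * Z) = exp Z * V - V * exp Z := by
  have : NormedAlgebra ℚ 𝔸 := NormedAlgebra.restrictScalars ℚ ℂ 𝔸
  have hV := hasDerivAt_exp_smul_zero V
  have hV' : HasDerivAt (fun t : ℂ => exp (-(t • V))) (-V) 0 := by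
    simpa using hasDerivAt_exp_smul_zero (-V)
  -- `ZV - VZ` is the velocity at `t = 0` of the conjugates `e^{-tV} Z e^{tV}`, and `exp` commutes
  -- with conjugation.
  have key : ∀ W : 𝔸, HasDerivAt (fun t : ℂ => exp (-(t • V)) * W * exp (t • V))
      (W * V - V * W) 0 := by
    intro W
    refine ((hV'.mul_const W).mul hV).congr_deriv ?_
    simp [sub_eq_add_neg, add_comm]
  have hinv : ∀ t : ℂ, exp (t • V) * exp (-(t • V)) = 1 := fun t => by
    rw [← NormedSpace.exp_add_of_commute (Commute.neg_right (Commute.refl _))]; simp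
  have hinv' : ∀ t : ℂ, exp (-(t • V)) * exp (t • V) = 1 := fun t => by
    rw [← NormedSpace.exp_add_of_commute (Commute.neg_left (Commute.refl _))]; simp
  have hconj : ∀ t : ℂ, exp (exp (-(t • V)) * Z * exp (t • V)) =
      exp (-(t • V)) * exp Z * exp (t • V) := fun t =>
    NormedSpace.exp_units_conj (⟨_, _, hinv' t, hinv t⟩ : 𝔸ˣ) Z
  have h1 : HasDerivAt (fun t : ℂ => exp (exp (-(t • V)) * Z * exp (t • V)))
      (fderiv ℂ exp Z (Z * V - V * Z)) 0 := by
    have h2 : HasFDerivAt exp (fderiv ℂ exp Z) (exp (-((0 : ℂ) • V)) * Z * exp ((0 : ℂ) • V)) := by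
      simpa using (differentiable_normedSpace_exp Z).hasFDerivAt
    exact h2.comp_hasDerivAt (0 : ℂ) (key Z)
  simp_rw [hconj] at h1
  exact h1.unique (key (exp Z))

theorem fderiv_exp_of_commute {Z W : 𝔸} (h : Commute Z W) :
    fderiv ℂ exp Z W = exp Z * W := by
  have : NormedAlgebra ℚ 𝔸 := NormedAlgebra.restrictScalars ℚ ℂ 𝔸
  have h1 : HasDerivAt (fun t : ℂ => exp (Z + t • W)) (fderiv ℂ exp Z W) 0 := by
    have h2 : HasFDerivAt exp (fderiv ℂ exp Z) (Z + (0 : ℂ) • W) := by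
      simpa using (differentiable_normedSpace_exp Z).hasFDerivAt
    refine h2.comp_hasDerivAt (0 : ℂ) ?_
    simpa using ((hasDerivAt_id (0 : ℂ)).smul_const W).const_add Z
  have h3 : (fun t : ℂ => exp (Z + t • W)) = fun t => exp Z * exp (t • W) := by
    ext1 t
    exact NormedSpace.exp_add_of_commute (h.smul_right t)
  rw [h3] at h1
  exact h1.unique ((hasDerivAt_exp_smul_zero W).const_mul (exp Z))

/-- The quotient `(1 - e^{-c}) / c`, extended by continuity. -/
noncomputable def expQuot (c : ℂ) : ℂ := if c = 0 then 1 else (1 - Complex.exp (-c)) / c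

/-- The left logarithmic derivative of the exponential, on an eigenvector of the commutator
with `Z`. -/
theorem exp_neg_mul_fderiv_exp_of_commutator {Z W : 𝔸} {c : ℂ} (h : Z * W - W * Z = c • W) :
    exp (-Z) * fderiv ℂ exp Z W = expQuot c • W := by
  have : NormedAlgebra ℚ 𝔸 := NormedAlgebra.restrictScalars ℚ ℂ 𝔸
  have h5 : exp (-Z) * exp Z = 1 := by
    rw [← NormedSpace.exp_add_of_commute (Commute.neg_left (Commute.refl Z))]; simp
  unfold expQuot
  split_ifs with hc
  · have h1 : Commute Z W := by
      rw [hc, zero_smul, sub_eq_zero] at h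
      exact h
    rw [fderiv_exp_of_commute h1, ← mul_assoc, h5, one_mul, one_smul]
  -- For `c ≠ 0` the direction `W` is itself a commutator with `Z`, so the previous formula applies.
  · have h1 : W = c⁻¹ • (Z * W - W * Z) := by rw [h, smul_smul, inv_mul_cancel₀ hc, one_smul]
    conv_lhs => rw [h1]
    rw [map_smul, fderiv_exp_commutator, mul_smul_comm, mul_sub, ← mul_assoc, h5, one_mul,
      ← mul_assoc, exp_neg_mul_mul_exp_of_commutator h, div_eq_inv_mul, ← smul_smul, sub_smul,
      one_smul]

end Exponential

/-! ### The value of the Liouville form on the left-invariant frame -/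

section LiouvilleForm

/-- The index set `Fin n × Fin 2`, with `(i, 0)` and `(i, 1)` sent to the two copies of `i`. -/
def matchedPairs (n : ℕ) : Fin n × Fin 2 ≃ Fin n ⊕ Fin n where
  toFun x := if x.2 = 0 then Sum.inl x.1 else Sum.inr x.1
  invFun := Sum.elim (fun i => (i, 0)) (fun i => (i, 1))
  left_inv := by
    rintro ⟨i, b⟩
    fin_cases b <;> simp
  right_inv := by
    rintro (i | i) <;> simp

/-- In terms of positions the permutation sends `2i + b` to `i + n b`. For each `i < j` exactly one
pair is inverted, `(i, 1)` against `(j, 0)`, so there are `n(n-1)/2` inversions. -/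
theorem sign_consecutivePairs_symm_trans (n : ℕ) :
    Equiv.Perm.sign ((consecutivePairs n).symm.trans (matchedPairs n)) =
      (-1) ^ (n * (n - 1) / 2) := by
  set e : Fin n ⊕ Fin n ≃ Fin (n * 2) := finSumFinEquiv.trans (finCongr (Nat.mul_two n).symm)
    with he
  set P : Equiv.Perm (Fin (n * 2)) := finProdFinEquiv.symm.trans ((matchedPairs n).trans e) with hP
  have h1 : Equiv.Perm.sign ((consecutivePairs n).symm.trans (matchedPairs n)) =
      Equiv.Perm.sign P := by
    refine Equiv.Perm.sign_eq_sign_of_equiv _ _ e fun x => ?_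
    simp only [hP, he, consecutivePairs, Equiv.trans_apply, Equiv.symm_trans_apply]
    congr 3
  have hval : ∀ i : Fin n, ∀ b : Fin 2, ((P (finProdFinEquiv (i, b)) : Fin (n * 2)) : ℕ) =
      (i : ℕ) + n * (b : ℕ) := by
    intro i b
    fin_cases b <;> simp [hP, he, matchedPairs, add_comm]
  have hinner : ∀ i j : Fin n, ∏ b : Fin 2, ∏ d : Fin 2,
      (if finProdFinEquiv (i, b) < finProdFinEquiv (j, d) then
        (if P (finProdFinEquiv (i, b)) < P (finProdFinEquiv (j, d)) then (1 : ℤˣ) else -1) else 1) =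
      if i < j then -1 else 1 := by
    intro i j
    simp only [Fin.prod_univ_two, Fin.lt_def, hval, finProdFinEquiv_apply_val, Fin.val_zero,
      Fin.val_one]
    have hi := i.2
    have hj := j.2
    rcases lt_trichotomy (i : ℕ) (j : ℕ) with h | h | h
    · rw [if_pos (by omega), if_pos (by omega), if_pos (by omega), if_pos (by omega),
        if_pos (by omega), if_neg (by omega), if_pos (by omega), if_pos (by omega), if_pos h]
      simp
    · rw [if_neg (by omega), if_pos (by omega), if_pos (by omega), if_neg (by omega),
        if_neg (by omega), if_neg (by omega)]
      simp
    · rw [if_neg (by omega), if_neg (by omega), if_neg (by omega), if_neg (by omega),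
        if_neg (by omega)]
      simp
  rw [h1, Equiv.Perm.sign_eq_prod_prod_Ioi]
  calc ∏ x, ∏ y ∈ Finset.Ioi x, (if P x < P y then (1 : ℤˣ) else -1)
      = ∏ x, ∏ y, (if x < y then (if P x < P y then (1 : ℤˣ) else -1) else 1) := by
        refine Finset.prod_congr rfl fun x _ => ?_
        rw [← Finset.prod_filter]
        refine Finset.prod_congr ?_ fun _ _ => rfl
        ext y
        simp
    _ = ∏ i : Fin n, ∏ j : Fin n, if i < j then (-1 : ℤˣ) else 1 := by
        rw [← finProdFinEquiv.prod_comp]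
        simp_rw [← finProdFinEquiv.prod_comp
          (fun y => if _ < y then (if P _ < P y then (1 : ℤˣ) else -1) else 1),
          Fintype.prod_prod_type]
        refine Finset.prod_congr rfl fun i _ => ?_
        rw [Finset.prod_comm]
        exact Finset.prod_congr rfl fun j _ => hinner i j
    _ = ∏ j : Fin n, (-1 : ℤˣ) ^ (j : ℕ) := by
        rw [Finset.prod_comm]
        refine Finset.prod_congr rfl fun j _ => ?_
        rw [← Finset.prod_filter, Finset.prod_const]
        congr 1
        rw [← Fin.card_Iio j]
        congr 1
        ext i
        simp
    _ = _ := by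
        rw [Finset.prod_pow_eq_pow_sum, Fin.sum_univ_eq_sum_range (fun i => i),
          Finset.sum_range_id]

/-- The Pfaffian-type sum of an antisymmetric pairing of two dual Lagrangian frames, of which only
one is known to be isotropic. -/
theorem sum_perm_pairing {n : ℕ} (w : Fin n × Fin 2 → Fin n × Fin 2 → ℝ)
    (h01 : ∀ i j, w (i, 0) (j, 1) = if i = j then 1 else 0)
    (h10 : ∀ i j, w (i, 1) (j, 0) = if i = j then -1 else 0)
    (h11 : ∀ i j, w (i, 1) (j, 1) = 0) :
    ∑ π : Equiv.Perm (Fin n × Fin 2), ((Equiv.Perm.sign π : ℤ) : ℝ) *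
      ∏ i : Fin n, w (π (i, 0)) (π (i, 1)) = 2 ^ n * n.factorial := by
  -- The contributing permutations permute the pairs and possibly flip each one: `2ⁿ n!` of them,
  -- each with term `1`, since the sign of a flip cancels the sign of `w`.
  let Φ : Equiv.Perm (Fin n) × (Fin n → Equiv.Perm (Fin 2)) → Equiv.Perm (Fin n × Fin 2) :=
    fun x => (Equiv.prodCongrRight x.2).trans (Equiv.prodCongrLeft fun _ => x.1)
  have hΦ : ∀ x i b, Φ x (i, b) = (x.1 i, x.2 i b) := fun x i b => rfl
  have hsign : ∀ x, Equiv.Perm.sign (Φ x) = ∏ i, Equiv.Perm.sign (x.2 i) := by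
    intro x
    rw [Equiv.Perm.sign_trans, Equiv.Perm.sign_prodCongrLeft, Equiv.Perm.sign_prodCongrRight]
    simp
  have hinj : Function.Injective Φ := by
    intro x y hxy
    have h : ∀ i b, x.1 i = y.1 i ∧ x.2 i b = y.2 i b := by
      intro i b
      have := congrArg (fun π => π (i, b)) hxy
      simpa [hΦ] using this
    refine Prod.ext (Equiv.ext fun i => (h i 0).1) (funext fun i => Equiv.ext fun b => (h i b).2)
  have hone : ∀ x, ((Equiv.Perm.sign (Φ x) : ℤ) : ℝ) *
      ∏ i : Fin n, w (Φ x (i, 0)) (Φ x (i, 1)) = 1 := by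
    intro x
    have h2 : ∀ i, w (Φ x (i, 0)) (Φ x (i, 1)) = ((Equiv.Perm.sign (x.2 i) : ℤ) : ℝ) := by
      intro i
      rw [hΦ, hΦ]
      have : ∀ f : Equiv.Perm (Fin 2), (f 0 = 0 ∧ f 1 = 1 ∧ Equiv.Perm.sign f = 1) ∨
          (f 0 = 1 ∧ f 1 = 0 ∧ Equiv.Perm.sign f = -1) := by decide
      rcases this (x.2 i) with ⟨h, h', h''⟩ | ⟨h, h', h''⟩
      · rw [h, h', h'', h01]; simp
      · rw [h, h', h'', h10]; simp
    rw [hsign, Finset.prod_congr rfl fun i _ => h2 i, Units.coe_prod, Int.cast_prod,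
      ← Finset.prod_mul_distrib]
    refine Finset.prod_eq_one fun i _ => ?_
    rcases Int.units_eq_one_or (Equiv.Perm.sign (x.2 i)) with h | h <;> rw [h] <;> simp
  have hzero : ∀ π : Equiv.Perm (Fin n × Fin 2), π ∉ Set.range Φ →
      ∏ i : Fin n, w (π (i, 0)) (π (i, 1)) = 0 := by
    intro π hπ
    by_contra hne
    apply hπ
    have hne' : ∀ i, w (π (i, 0)) (π (i, 1)) ≠ 0 := fun i =>
      Finset.prod_ne_zero_iff.1 hne i (Finset.mem_univ i)
    have hle : ∀ i, ((π (i, 0)).2 : ℕ) + ((π (i, 1)).2 : ℕ) ≤ 1 := by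
      intro i
      by_contra hlt
      have h0 : (π (i, 0)).2 = 1 := by omega
      have h1 : (π (i, 1)).2 = 1 := by omega
      apply hne' i
      rw [← Prod.mk.eta (p := π (i, 0)), ← Prod.mk.eta (p := π (i, 1)), h0, h1, h11]
    -- There are `n` entries of second kind in all and at most one in each of the `n` pairs, hence
    -- exactly one in each. So the values `w (i, 0) (j, 0)`, which carry the bracket term of `ω`,
    -- never enter.
    have hsum : ∑ i : Fin n, (((π (i, 0)).2 : ℕ) + ((π (i, 1)).2 : ℕ)) = ∑ i : Fin n, 1 := by
      have := Equiv.sum_comp π (fun x : Fin n × Fin 2 => ((x.2 : Fin 2) : ℕ))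
      rw [Fintype.sum_prod_type, Fintype.sum_prod_type] at this
      simpa [Fin.sum_univ_two] using this
    have heq : ∀ i, ((π (i, 0)).2 : ℕ) + ((π (i, 1)).2 : ℕ) = 1 := fun i =>
      (Finset.sum_eq_sum_iff_of_le fun i _ => hle i).1 hsum i (Finset.mem_univ i)
    have hfst : ∀ i, (π (i, 0)).1 = (π (i, 1)).1 := by
      intro i
      by_contra hfne
      apply hne' i
      rw [← Prod.mk.eta (p := π (i, 0)), ← Prod.mk.eta (p := π (i, 1))]
      have hcase : ((π (i, 0)).2 = 0 ∧ (π (i, 1)).2 = 1) ∨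
          ((π (i, 0)).2 = 1 ∧ (π (i, 1)).2 = 0) := by
        have := heq i
        omega
      rcases hcase with ⟨h, h'⟩ | ⟨h, h'⟩
      · rw [h, h', h01, if_neg hfne]
      · rw [h, h', h10, if_neg hfne]
    have hfst' : ∀ i b, (π (i, b)).1 = (π (i, 0)).1 := by
      intro i b
      fin_cases b
      · rfl
      · exact (hfst i).symm
    have hσ : Function.Bijective fun i => (π (i, 0)).1 := by
      refine Finite.surjective_iff_bijective.1 fun j => ?_
      refine ⟨(π.symm (j, 0)).1, ?_⟩
      rw [← hfst' _ (π.symm (j, 0)).2, Prod.mk.eta, Equiv.apply_symm_apply]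
    have hf : ∀ i, Function.Bijective fun b => (π (i, b)).2 := by
      intro i
      refine Finite.injective_iff_bijective.1 fun b d hbd => ?_
      have : π (i, b) = π (i, d) := Prod.ext ((hfst' i b).trans (hfst' i d).symm) hbd
      simpa using π.injective this
    refine ⟨(Equiv.ofBijective _ hσ, fun i => Equiv.ofBijective _ (hf i)), ?_⟩
    ext1 ⟨i, b⟩
    rw [hΦ]
    exact Prod.ext (hfst' i b).symm rfl
  rw [← Finset.sum_of_injOn (s := Finset.univ) (t := Finset.univ) (f := fun _ => (1 : ℝ)) Φ
    hinj.injOn (fun _ _ => Finset.mem_coe.2 (Finset.mem_univ _))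
    (fun π _ hπ => by rw [hzero π (by simpa using hπ), mul_zero]) (fun x _ => (hone x).symm)]
  simp [Fintype.card_perm, mul_comm]

variable {n : ℕ} {E : Type*} [NormedAddCommGroup E] [InnerProductSpace ℝ E]
  {K : Type*} [Group K] [TopologicalSpace K] [ChartedSpace E K]

theorem bracket_zero_left (v : E) :
    (Bracket.bracket (L := GroupLieAlgebra 𝓘(ℝ, E) K) (M := GroupLieAlgebra 𝓘(ℝ, E) K)
      (0 : E) v : E) = 0 := by
  have h : mulInvariantVectorField (I := 𝓘(ℝ, E)) (G := K) (0 : E) = 0 := by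
    ext x
    exact map_zero (mfderiv 𝓘(ℝ, E) 𝓘(ℝ, E) (fun y : K => x * y) 1)
  change VectorField.mlieBracket 𝓘(ℝ, E) (mulInvariantVectorField (0 : E)) _ (1 : K) = 0
  rw [h, VectorField.mlieBracket_zero_left]
  rfl

theorem bracket_zero_right (v : E) :
    (Bracket.bracket (L := GroupLieAlgebra 𝓘(ℝ, E) K) (M := GroupLieAlgebra 𝓘(ℝ, E) K)
      v (0 : E) : E) = 0 := by
  have h : mulInvariantVectorField (I := 𝓘(ℝ, E)) (G := K) (0 : E) = 0 := by
    ext x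
    exact map_zero (mfderiv 𝓘(ℝ, E) 𝓘(ℝ, E) (fun y : K => x * y) 1)
  change VectorField.mlieBracket 𝓘(ℝ, E) _ (mulInvariantVectorField (0 : E)) (1 : K) = 0
  rw [h, VectorField.mlieBracket_zero_right]
  rfl

/-- The Liouville form takes a constant value on the left-invariant frame. -/
theorem liouvilleForm_cotangentFrame (X : OrthonormalBasis (Fin n) ℝ E) (p : K × E) :
    liouvilleForm p (cotangentFrame X) = (-1) ^ (n * (n - 1) / 2) := by
  unfold liouvilleForm
  -- Reindexing by permutations of `Fin n × Fin 2` turns the sum into that of `sum_perm_pairing`, at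
  -- the cost of the sign of the change of ordering.
  rw [← (Equiv.equivCongr (consecutivePairs n) (matchedPairs n)).sum_comp]
  set Ω : Fin n ⊕ Fin n → Fin n ⊕ Fin n → ℝ :=
    fun a b => symplecticForm p (cotangentFrame X a) (cotangentFrame X b)
  have hval : ∀ a b, Ω a b = inner ℝ (cotangentFrame X a).1 (cotangentFrame X b).2 -
      inner ℝ (cotangentFrame X a).2 (cotangentFrame X b).1 + inner ℝ p.2
        (Bracket.bracket (L := GroupLieAlgebra 𝓘(ℝ, E) K) (M := GroupLieAlgebra 𝓘(ℝ, E) K)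
          (cotangentFrame X a).1 (cotangentFrame X b).1 : E) :=
    fun a b => rfl
  have key := sum_perm_pairing (fun x y => Ω (matchedPairs n x) (matchedPairs n y))
    (fun i j => by
      change Ω (Sum.inl i) (Sum.inr j) = _
      simp only [hval, cotangentFrame, Sum.elim_inl, Sum.elim_inr]
      rw [bracket_zero_right]
      simp only [inner_zero_left, X.inner_eq_ite, sub_zero]
      exact add_eq_left.2 (inner_zero_right (𝕜 := ℝ) p.2))
    (fun i j => by
      change Ω (Sum.inr i) (Sum.inl j) = _
      simp only [hval, cotangentFrame, Sum.elim_inl, Sum.elim_inr]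
      rw [bracket_zero_left]
      simp only [inner_zero_right, X.inner_eq_ite]
      refine (add_eq_left.2 (inner_zero_right (𝕜 := ℝ) p.2)).trans ?_
      split_ifs <;> simp)
    (fun i j => by
      change Ω (Sum.inr i) (Sum.inr j) = _
      simp only [hval, cotangentFrame, Sum.elim_inr]
      rw [bracket_zero_right]
      simp only [inner_zero_left, inner_zero_right, sub_zero]
      exact add_eq_left.2 (inner_zero_right (𝕜 := ℝ) p.2))
  have hterm : ∀ π : Equiv.Perm (Fin n × Fin 2),
      ((Equiv.Perm.sign (Equiv.equivCongr (consecutivePairs n) (matchedPairs n) π) : ℤ) : ℝ) *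
        ∏ i : Fin n, Ω (Equiv.equivCongr (consecutivePairs n) (matchedPairs n) π
          (consecutivePairs n (i, 0))) (Equiv.equivCongr (consecutivePairs n) (matchedPairs n) π
          (consecutivePairs n (i, 1))) = (-1) ^ (n * (n - 1) / 2) *
      (((Equiv.Perm.sign π : ℤ) : ℝ) *
        ∏ i : Fin n, Ω (matchedPairs n (π (i, 0))) (matchedPairs n (π (i, 1)))) := by
    intro π
    have hs : Equiv.Perm.sign (Equiv.equivCongr (consecutivePairs n) (matchedPairs n) π) =
        Equiv.Perm.sign π * (-1) ^ (n * (n - 1) / 2) := by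
      rw [← sign_consecutivePairs_symm_trans, ← Equiv.Perm.sign_trans_trans]
      rfl
    rw [hs]
    simp only [Equiv.equivCongr_apply_apply, Equiv.symm_apply_apply]
    push_cast
    ring
  rw [Finset.sum_congr rfl fun π _ => hterm π, ← Finset.mul_sum, key]
  field_simp

end LiouvilleForm

noncomputable section

/-! ### The logarithmic derivative of `ψ_s` -/

section LogarithmicDerivative

variable {n N : ℕ}
  {E : Type*} [NormedAddCommGroup E] [InnerProductSpace ℝ E] [FiniteDimensional ℝ E]
  {K : Type*} [Group K] [TopologicalSpace K] [ChartedSpace E K]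

open NormedSpace (exp)

/-- The exponent `i s dρ(Y)`. -/
def psiExponent (K : Type*) [Group K] [TopologicalSpace K] [ChartedSpace E K]
    (ρ : K →* unitary (Mat N)) (s : ℝ) : E →L[ℝ] Mat N :=
  ⟨(Complex.I * (s : ℂ)) • repDerivLM ρ, LinearMap.continuous_of_finiteDimensional _⟩

theorem psiExponent_apply (ρ : K →* unitary (Mat N)) (s : ℝ) (Y : E) :
    psiExponent K ρ s Y = (Complex.I * (s : ℂ)) • repDeriv ρ Y := rfl

variable [LieGroup 𝓘(ℝ, E) ∞ K]

/-- Product rule for `ρ(x) e^Z` with `Z = i s dρ(Y)`. The unitary factor `ρ(x)` cancels, so the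
result does not depend on `x`. -/
theorem psiLogDeriv_eq {ρ : K →* unitary (Mat N)}
    (hρ : ContMDiff 𝓘(ℝ, E) 𝓘(ℝ, Mat N) ∞ fun x : K => (ρ x : Mat N)) (s : ℝ) (x : K) (Y u a : E) :
    psiLogDeriv ρ s (x, Y) (u, a) =
      exp (-psiExponent K ρ s Y) * repDeriv ρ u * exp (psiExponent K ρ s Y) +
      exp (-psiExponent K ρ s Y) * fderiv ℂ exp (psiExponent K ρ s Y) (psiExponent K ρ s a) := by
  have : NormedAlgebra ℚ (Mat N) := NormedAlgebra.restrictScalars ℚ ℂ (Mat N)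
  set Z := psiExponent K ρ s Y with hZ
  have hψ : ∀ q : K × E, psi ρ s q = (ρ q.1 : Mat N) * exp (psiExponent K ρ s q.2) := fun q => rfl
  have hρd : ∀ y, MDifferentiableAt 𝓘(ℝ, E) 𝓘(ℝ, Mat N) (fun x : K => (ρ x : Mat N)) y :=
    fun y => (hρ y).mdifferentiableAt (by simp)
  have hexp : HasFDerivAt (fun Y : E => exp (psiExponent K ρ s Y))
      (((fderiv ℂ exp Z).restrictScalars ℝ).comp (psiExponent K ρ s)) Y :=
    ((differentiable_normedSpace_exp Z).hasFDerivAt.restrictScalars ℝ).comp Y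
      (psiExponent K ρ s).hasFDerivAt
  have hd : MDifferentiableAt (𝓘(ℝ, E).prod 𝓘(ℝ, E)) 𝓘(ℝ, Mat N) (psi ρ s : K × E → Mat N)
      (x, Y) := by
    have h1 : MDifferentiableAt (𝓘(ℝ, E).prod 𝓘(ℝ, E)) 𝓘(ℝ, Mat N)
        (fun q : K × E => (ρ q.1 : Mat N)) (x, Y) :=
      MDifferentiableAt.comp (x, Y) (g := fun x : K => (ρ x : Mat N)) (f := Prod.fst) (hρd x)
        mdifferentiableAt_fst
    have h2 : MDifferentiableAt (𝓘(ℝ, E).prod 𝓘(ℝ, E)) 𝓘(ℝ, Mat N)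
        (fun q : K × E => exp (psiExponent K ρ s q.2)) (x, Y) :=
      MDifferentiableAt.comp (x, Y) (g := fun Y : E => exp (psiExponent K ρ s Y)) (f := Prod.snd)
        (mdifferentiableAt_iff_differentiableAt.2 hexp.differentiableAt) mdifferentiableAt_snd
    exact h1.mul h2
  have hdir : dirDeriv (psi ρ s) (x, Y) (u, a) =
      (ρ x : Mat N) * repDeriv ρ u * exp Z +
        (ρ x : Mat N) * fderiv ℂ exp Z (psiExponent K ρ s a) := by
    unfold dirDeriv
    have h0 := mfderiv_prod_eq_add_apply hd
      (v := ((mulInvariantVectorField (I := 𝓘(ℝ, E)) (G := K) u x, a) : E × E))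
    refine h0.trans ?_
    have h1 : HasMFDerivAt 𝓘(ℝ, E) 𝓘(ℝ, Mat N)
        (fun z : K => psi ρ s (z, Y)) x _ :=
      HasMFDerivAt.comp x
        ((ContinuousLinearMap.mul ℝ (Mat N)).flip (exp Z)).hasMFDerivAt (hρd x).hasMFDerivAt
    have h2 : HasMFDerivAt 𝓘(ℝ, E) 𝓘(ℝ, Mat N)
        (fun z : E => psi ρ s (x, z)) Y _ :=
      HasMFDerivAt.comp Y (ContinuousLinearMap.mul ℝ (Mat N) (ρ x : Mat N)).hasMFDerivAt
        hexp.hasMFDerivAt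
    refine congrArg₂ (· + ·) ?_ ?_
    · refine (congrArg (fun L => L (mulInvariantVectorField (I := 𝓘(ℝ, E)) (G := K) u x))
        h1.mfderiv).trans ?_
      exact congrArg (fun M : Mat N => M * exp Z) (mfderiv_rep_mulInvariantVectorField hρ x u)
    · exact congrArg (fun L => L a) h2.mfderiv
  have hinv : Ring.inverse (psi ρ s (x, Y)) = exp (-Z) * star (ρ x : Mat N) := by
    have h5 : exp (-Z) * exp Z = 1 := by
      rw [← NormedSpace.exp_add_of_commute (Commute.neg_left (Commute.refl Z))]; simp
    have h6 : exp Z * exp (-Z) = 1 := by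
      rw [← NormedSpace.exp_add_of_commute (Commute.neg_right (Commute.refl Z))]; simp
    have h7 : star (ρ x : Mat N) * (ρ x : Mat N) = 1 := Unitary.coe_star_mul_self _
    have h8 : (ρ x : Mat N) * star (ρ x : Mat N) = 1 := Unitary.coe_mul_star_self _
    refine Ring.inverse_unit (⟨(ρ x : Mat N) * exp Z, exp (-Z) * star (ρ x : Mat N), ?_, ?_⟩ :
      (Mat N)ˣ)
    · rw [mul_assoc, ← mul_assoc (exp Z), h6, one_mul, h8]
    · rw [mul_assoc, ← mul_assoc (star (ρ x : Mat N)), h7, one_mul, h5]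
  have h7 : ∀ M : Mat N, star (ρ x : Mat N) * ((ρ x : Mat N) * M) = M := fun M => by
    rw [← mul_assoc, Unitary.coe_star_mul_self, one_mul]
  unfold psiLogDeriv
  rw [hdir, hinv, mul_add]
  simp only [mul_assoc, h7]

end LogarithmicDerivative

/-! ### Coordinates on the complexified Lie algebra -/

section ComplexLieAlgebra

theorem eq_zero_of_add_I_smul_eq_zero {A : Type*} [AddCommGroup A] [Module ℂ A] [StarAddMonoid A]
    [StarModule ℂ A] {x y : A} (hx : star x = -x) (hy : star y = -y)
    (h : x + Complex.I • y = 0) : x = 0 ∧ y = 0 := by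
  have h' := congrArg star h
  rw [star_add, star_smul, hx, hy, star_zero] at h'
  simp only [RCLike.star_def, Complex.conj_I, smul_neg, neg_smul, neg_neg] at h'
  have h1 : (2 : ℂ) • (Complex.I • y) = 0 := by
    rw [two_smul]
    calc _ = (x + Complex.I • y) + (-x + Complex.I • y) := by abel
      _ = 0 := by rw [h, h', add_zero]
  have hy0 : y = 0 := by simpa using h1
  exact ⟨by simpa [hy0] using h, hy0⟩

variable {n N : ℕ}
  {E : Type*} [NormedAddCommGroup E] [InnerProductSpace ℝ E]
  {K : Type*} [Group K] [TopologicalSpace K] [ChartedSpace E K]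

/-- The coordinates `c ↦ ∑ c_k dρ(X_k)` of the complexified Lie algebra. -/
def complexCoord (X : OrthonormalBasis (Fin n) ℝ E) (ρ : K →* unitary (Mat N)) :
    (Fin n → ℂ) →ₗ[ℂ] Mat N :=
  Fintype.linearCombination ℂ fun k => repDeriv ρ (X k)

theorem complexCoord_apply (X : OrthonormalBasis (Fin n) ℝ E) (ρ : K →* unitary (Mat N))
    (c : Fin n → ℂ) : complexCoord X ρ c = ∑ k, c k • repDeriv ρ (X k) := rfl

theorem complexCoord_ofReal (X : OrthonormalBasis (Fin n) ℝ E) (ρ : K →* unitary (Mat N))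
    (c : Fin n → ℝ) : complexCoord X ρ (fun k => (c k : ℂ)) = repDeriv ρ (∑ k, c k • X k) := by
  rw [complexCoord_apply, ← repDerivLM_apply, map_sum]
  refine Finset.sum_congr rfl fun k _ => ?_
  rw [map_smul, repDerivLM_apply]
  exact algebraMap_smul ℂ (c k) (repDeriv ρ (X k) : Mat N)

theorem complexCoord_repr (X : OrthonormalBasis (Fin n) ℝ E) (ρ : K →* unitary (Mat N))
    (u : E) : complexCoord X ρ (fun k => ((inner ℝ (X k) u : ℝ) : ℂ)) = repDeriv ρ u := by
  rw [complexCoord_ofReal, X.sum_repr']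

theorem complexCoord_single (X : OrthonormalBasis (Fin n) ℝ E) (ρ : K →* unitary (Mat N))
    (j : Fin n) : complexCoord X ρ (Pi.single j 1) = repDeriv ρ (X j) := by
  have := Fintype.linearCombination_apply_single ℂ (fun k => repDeriv ρ (X k)) j 1
  rw [one_smul] at this
  exact this

variable [LieGroup 𝓘(ℝ, E) ∞ K] [FiniteDimensional ℝ E]

/-- The image of `dρ` consists of skew-adjoint matrices, so it meets `i` times itself only in zero:
real and imaginary parts of the coordinates vanish separately. -/
theorem complexCoord_injective (X : OrthonormalBasis (Fin n) ℝ E) {ρ : K →* unitary (Mat N)}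
    (hinj : Function.Injective ρ)
    (hρ : ContMDiff 𝓘(ℝ, E) 𝓘(ℝ, Mat N) ∞ fun x : K => (ρ x : Mat N)) :
    Function.Injective (complexCoord X ρ) := by
  refine (injective_iff_map_eq_zero _).2 fun c hc => ?_
  have hsplit : complexCoord X ρ c = repDeriv ρ (∑ k, (c k).re • X k) +
      Complex.I • repDeriv ρ (∑ k, (c k).im • X k) := by
    rw [← complexCoord_ofReal, ← complexCoord_ofReal, ← map_smul, ← map_add]
    congr 1
    ext k
    simp [mul_comm Complex.I]
  rw [hsplit] at hc
  set a := ∑ k, (c k).re • X k with ha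
  set b := ∑ k, (c k).im • X k with hb
  obtain ⟨ha0, hb0⟩ := eq_zero_of_add_I_smul_eq_zero (star_repDeriv hρ a) (star_repDeriv hρ b) hc
  have hz : ∀ w : E, repDeriv ρ w = 0 → w = 0 := fun w hw =>
    repDeriv_injective hinj hρ (hw.trans (map_zero (repDerivLM (E := E) ρ)).symm)
  ext k
  have hcoord : ∀ d : Fin n → ℝ, inner ℝ (X k) (∑ j, d j • X j) = d k := fun d => by
    simp [inner_sum, inner_smul_right, X.inner_eq_ite]
  apply Complex.ext
  · have := hcoord fun j => (c j).re
    rw [← ha, hz a ha0, inner_zero_right] at this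
    exact this.symm
  · have := hcoord fun j => (c j).im
    rw [← hb, hz b hb0, inner_zero_right] at this
    exact this.symm

/-- In coordinates, `i` times the commutator with `dρ(Y)` is a traceless Hermitian matrix with
imaginary entries. -/
theorem exists_hermitian_commutator (hAd : IsAdInvariant (E := E) K)
    (X : OrthonormalBasis (Fin n) ℝ E) {ρ : K →* unitary (Mat N)} (hinj : Function.Injective ρ)
    (hρ : ContMDiff 𝓘(ℝ, E) 𝓘(ℝ, Mat N) ∞ fun x : K => (ρ x : Mat N)) (Y : E) :
    ∃ A : Matrix (Fin n) (Fin n) ℂ, A.IsHermitian ∧ A.map (starRingEnd ℂ) = -A ∧ A.trace = 0 ∧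
      ∀ (s : ℝ) (c : Fin n → ℂ), psiExponent K ρ s Y * complexCoord X ρ c -
        complexCoord X ρ c * psiExponent K ρ s Y = (s : ℂ) • complexCoord X ρ (A.mulVec c) := by
  obtain ⟨B, hB, hskew⟩ := exists_skew_bracket hAd hinj hρ Y
  have hM : ∀ j k, inner ℝ (X k) (B (X j)) = -inner ℝ (X j) (B (X k)) := by
    intro j k
    have := hskew (X j) (X k)
    rw [real_inner_comm] at this
    linarith
  -- The matrix is `i` times that of the bracket with `Y`, which is real and skew in the orthonormal
  -- basis.
  refine ⟨Matrix.of fun j k => Complex.I * ((inner ℝ (X j) (B (X k)) : ℝ) : ℂ), ?_, ?_, ?_, ?_⟩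
  · ext j k
    simp [hM k j]
  · ext j k
    simp
  · refine Finset.sum_eq_zero fun j _ => ?_
    have : inner ℝ (X j) (B (X j)) = 0 := by linarith [hM j j]
    simp [this]
  · intro s c
    have hbasis : ∀ k, repDeriv ρ Y * repDeriv ρ (X k) - repDeriv ρ (X k) * repDeriv ρ Y =
        complexCoord X ρ (fun j => ((inner ℝ (X j) (B (X k)) : ℝ) : ℂ)) := fun k => by
      rw [complexCoord_repr, hB]
    have h1 : repDeriv ρ Y * complexCoord X ρ c - complexCoord X ρ c * repDeriv ρ Y =
        complexCoord X ρ (fun j => ∑ k, ((inner ℝ (X j) (B (X k)) : ℝ) : ℂ) * c k) := by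
      have h2 : (fun j => ∑ k, ((inner ℝ (X j) (B (X k)) : ℝ) : ℂ) * c k) =
          ∑ k, c k • fun j => ((inner ℝ (X j) (B (X k)) : ℝ) : ℂ) := by
        ext j
        simp [mul_comm]
      rw [h2, map_sum, complexCoord_apply, Finset.mul_sum, Finset.sum_mul,
        ← Finset.sum_sub_distrib]
      refine Finset.sum_congr rfl fun k _ => ?_
      rw [map_smul, ← hbasis, mul_smul_comm, smul_mul_assoc, smul_sub]
    rw [psiExponent_apply, smul_mul_assoc, mul_smul_comm]
    refine (smul_sub _ (repDeriv ρ Y * complexCoord X ρ c : Mat N) _).symm.trans ?_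
    rw [h1, mul_comm, mul_smul, ← map_smul]
    congr 2
    ext j
    simp [Matrix.mulVec, dotProduct, Finset.mul_sum, mul_assoc]

end ComplexLieAlgebra

end

noncomputable section

/-! ### Matrices diagonalized together with a Hermitian matrix -/

section EigenAction

variable {n : ℕ}

/-- `F` acts on every eigenvector of `A` with real eigenvalue `l` as multiplication by `f l`. -/
def EigenAction (A F : Matrix (Fin n) (Fin n) ℂ) (f : ℝ → ℂ) : Prop :=
  ∀ (l : ℝ) (v : Fin n → ℂ), A.mulVec v = (l : ℂ) • v → F.mulVec v = f l • v

/-- Since `conj A = -A`, conjugating an eigenvector for `l` gives one for `-l`. -/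
theorem EigenAction.conj {A F : Matrix (Fin n) (Fin n) ℂ} {f : ℝ → ℂ} (h : EigenAction A F f)
    (hA : A.map (starRingEnd ℂ) = -A) :
    EigenAction A (F.map (starRingEnd ℂ)) fun l => starRingEnd ℂ (f (-l)) := by
  have hmap : ∀ (B : Matrix (Fin n) (Fin n) ℂ) (v : Fin n → ℂ),
      (fun i => starRingEnd ℂ (B.mulVec v i)) =
        (B.map (starRingEnd ℂ)).mulVec fun i => starRingEnd ℂ (v i) := fun B v => by
    ext i
    simp [Matrix.mulVec, dotProduct]
  intro l v hv
  have h1 : A.mulVec (fun i => starRingEnd ℂ (v i)) =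
      ((-l : ℝ) : ℂ) • fun i => starRingEnd ℂ (v i) := by
    have h2 := hmap A v
    rw [hA, hv, Matrix.neg_mulVec] at h2
    rw [← neg_eq_iff_eq_neg] at h2
    rw [← h2]
    ext i
    simp
  have h2 := h _ _ h1
  have h3 := hmap F (fun i => starRingEnd ℂ (v i))
  simp only [Complex.conj_conj] at h3
  rw [h2] at h3
  rw [← h3]
  ext i
  simp

theorem EigenAction.mul_eigenvectorUnitary {A F : Matrix (Fin n) (Fin n) ℂ} {f : ℝ → ℂ}
    (h : EigenAction A F f) (hA : A.IsHermitian) :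
    F * (hA.eigenvectorUnitary : Matrix (Fin n) (Fin n) ℂ) =
      (hA.eigenvectorUnitary : Matrix (Fin n) (Fin n) ℂ) *
        Matrix.diagonal fun j => f (hA.eigenvalues j) := by
  ext i j
  have h1 := congrFun (h (hA.eigenvalues j) _ (hA.mulVec_eigenvectorBasis j)) i
  rw [Matrix.mul_diagonal, hA.eigenvectorUnitary_apply]
  simp only [Pi.smul_apply, smul_eq_mul] at h1
  rw [mul_comm, ← h1, Matrix.mul_apply]
  simp [Matrix.mulVec, dotProduct]

/-- One unitary diagonalizes all four blocks; the Schur complement formula then applies, with the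
first block invertible because `f₁` has no zero. -/
theorem EigenAction.det_fromBlocks {A F₁ F₂ F₃ F₄ : Matrix (Fin n) (Fin n) ℂ} {f₁ f₂ f₃ f₄ : ℝ → ℂ}
    (hA : A.IsHermitian) (h₁ : EigenAction A F₁ f₁) (h₂ : EigenAction A F₂ f₂)
    (h₃ : EigenAction A F₃ f₃) (h₄ : EigenAction A F₄ f₄) (hf : ∀ l, f₁ l ≠ 0) :
    (Matrix.fromBlocks F₁ F₂ F₃ F₄).det = ∏ j, (f₁ (hA.eigenvalues j) * f₄ (hA.eigenvalues j) -
      f₃ (hA.eigenvalues j) * f₂ (hA.eigenvalues j)) := by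
  set U : Matrix (Fin n) (Fin n) ℂ := (hA.eigenvectorUnitary : Matrix (Fin n) (Fin n) ℂ)
  have hU : (Matrix.fromBlocks U 0 0 U).det ≠ 0 := by
    have : U.det ≠ 0 := by
      have h := congrArg Matrix.det (Unitary.coe_star_mul_self hA.eigenvectorUnitary)
      rw [Matrix.det_mul, Matrix.det_one] at h
      exact right_ne_zero_of_mul_eq_one h
    rw [Matrix.det_fromBlocks_zero₂₁]
    exact mul_ne_zero this this
  let D : (ℝ → ℂ) → Matrix (Fin n) (Fin n) ℂ := fun f => Matrix.diagonal fun j =>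
    f (hA.eigenvalues j)
  have hmul : Matrix.fromBlocks F₁ F₂ F₃ F₄ * Matrix.fromBlocks U 0 0 U =
      Matrix.fromBlocks U 0 0 U * Matrix.fromBlocks (D f₁) (D f₂) (D f₃) (D f₄) := by
    simp only [Matrix.fromBlocks_multiply, Matrix.mul_zero, Matrix.zero_mul, add_zero, zero_add]
    rw [h₁.mul_eigenvectorUnitary hA, h₂.mul_eigenvectorUnitary hA, h₃.mul_eigenvectorUnitary hA,
      h₄.mul_eigenvectorUnitary hA]
  have hdet := congrArg Matrix.det hmul
  rw [Matrix.det_mul, Matrix.det_mul, mul_comm] at hdet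
  rw [mul_left_cancel₀ hU hdet]
  have : Invertible (D f₁) := by
    refine ⟨D fun l => (f₁ l)⁻¹, ?_, ?_⟩ <;>
    · simp only [D, Matrix.diagonal_mul_diagonal]
      rw [← Matrix.diagonal_one]
      congr 1
      ext j
      simp [hf]
  have hinv : ⅟(D f₁) = D fun l => (f₁ l)⁻¹ := by
    refine invOf_eq_right_inv ?_
    simp only [D, Matrix.diagonal_mul_diagonal]
    rw [← Matrix.diagonal_one]
    congr 1
    ext j
    simp [hf]
  rw [Matrix.det_fromBlocks₁₁, hinv]
  simp only [D, Matrix.diagonal_mul_diagonal, Matrix.diagonal_sub, Matrix.det_diagonal]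
  rw [← Finset.prod_mul_distrib]
  refine Finset.prod_congr rfl fun j _ => ?_
  have := hf (hA.eigenvalues j)
  field_simp

/-- A linear map which is multiplication by `f l` on the images of the eigenvectors of `A` is
conjugate to a matrix. -/
theorem exists_eigenAction {V : Type*} [AddCommGroup V] [Module ℂ V]
    {A : Matrix (Fin n) (Fin n) ℂ} (hA : A.IsHermitian) {S : (Fin n → ℂ) →ₗ[ℂ] V}
    (hS : Function.Injective S) (Φ : V →ₗ[ℂ] V) (f : ℝ → ℂ)
    (h : ∀ (l : ℝ) (v : Fin n → ℂ), A.mulVec v = (l : ℂ) • v → Φ (S v) = f l • S v) :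
    ∃ F, EigenAction A F f ∧ ∀ c, Φ (S c) = S (F.mulVec c) := by
  obtain ⟨L, hL⟩ := S.exists_leftInverse_of_injective (LinearMap.ker_eq_bot.2 hS)
  have hL' : ∀ c, L (S c) = c := fun c => congrArg (fun g => g c) hL
  refine ⟨LinearMap.toMatrix' (L ∘ₗ Φ ∘ₗ S), ?_, ?_⟩
  · intro l v hv
    rw [LinearMap.toMatrix'_mulVec, LinearMap.comp_apply, LinearMap.comp_apply, h l v hv, map_smul,
      hL']
  · intro c
    -- The two linear maps agree on an eigenbasis of `A`. In particular the range of `S` is stable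
    -- under `Φ`.
    have hlin : Φ ∘ₗ S = S ∘ₗ (L ∘ₗ Φ ∘ₗ S) := by
      refine (hA.eigenvectorBasis.toBasis.map (WithLp.linearEquiv 2 ℂ (Fin n → ℂ))).ext fun j => ?_
      have hv := h _ _ (hA.mulVec_eigenvectorBasis j)
      have hb : (hA.eigenvectorBasis.toBasis.map (WithLp.linearEquiv 2 ℂ (Fin n → ℂ))) j =
        (hA.eigenvectorBasis j : Fin n → ℂ) := by simp
      rw [hb]
      simp only [LinearMap.comp_apply]
      rw [hv, map_smul, map_smul, hL']
    rw [LinearMap.toMatrix'_mulVec]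
    exact congrArg (fun g => g c) hlin

end EigenAction

/-! ### The determinant in one eigendirection -/

section SinhQuot

/-- The quotient `sinh (r l) / l`, extended by continuity. -/
def sinhQuot (r l : ℝ) : ℝ := if l = 0 then r else Real.sinh (r * l) / l

theorem sinhQuot_pos {r : ℝ} (hr : 0 < r) (l : ℝ) : 0 < sinhQuot r l := by
  unfold sinhQuot
  split_ifs with hl
  · exact hr
  · rcases lt_or_gt_of_ne hl with h | h
    · exact div_pos_of_neg_of_neg (Real.sinh_neg_iff.2 (mul_neg_of_pos_of_neg hr h)) h
    · exact div_pos (Real.sinh_pos_iff.2 (mul_pos hr h)) h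

/-- The left side is `(i/l) (e^{sl} (1 - e^{-s'l}) + e^{-s'l} (e^{sl} - 1)) = (i/l) (e^{sl} -
e^{-s'l})`; factoring out `e^{(s-s')l/2}` leaves a `sinh`. The case `l = 0` is separate. -/
theorem expQuot_block (s s' l : ℝ) :
    starRingEnd ℂ (Complex.exp (-((s * -l : ℝ) : ℂ))) *
        (Complex.I * s' * expQuot ((s' * l : ℝ) : ℂ)) -
      Complex.exp (-((s' * l : ℝ) : ℂ)) *
        starRingEnd ℂ (Complex.I * s * expQuot ((s * -l : ℝ) : ℂ)) =
      2 * Complex.I * (Complex.exp (((s - s') / 2 * l : ℝ) : ℂ) *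
        ((sinhQuot ((s + s') / 2) l : ℝ) : ℂ)) := by
  obtain ⟨q, hreal, hq⟩ : ∃ q : ℝ → ℝ, (∀ c : ℝ, expQuot (c : ℂ) = (q c : ℂ)) ∧
      ∀ c, q c = if c = 0 then 1 else (1 - Real.exp (-c)) / c := by
    refine ⟨fun c => if c = 0 then 1 else (1 - Real.exp (-c)) / c, fun c => ?_, fun c => rfl⟩
    unfold expQuot
    split_ifs <;> simp_all
  have key : Real.exp (s * l) * (s' * q (s' * l)) + Real.exp (-(s' * l)) * (s * q (s * -l)) =
      2 * (Real.exp ((s - s') / 2 * l) * sinhQuot ((s + s') / 2) l) := by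
    unfold sinhQuot
    by_cases hl : l = 0
    · simp [hl, hq]
      ring
    have h1 : ∀ c : ℝ, c * q (c * l) =
        (1 - Real.exp (-(c * l))) / l := fun c => by
      by_cases hc : c = 0
      · simp [hc]
      · rw [hq, if_neg (mul_ne_zero hc hl)]
        field_simp
    have h2 : s * q (s * -l) = (Real.exp (s * l) - 1) / l := by
      by_cases hc : s = 0
      · simp [hc]
      · rw [hq, if_neg (mul_ne_zero hc (neg_ne_zero.2 hl))]
        rw [mul_neg, neg_neg]
        field_simp
        ring
    rw [h1, h2, if_neg hl, Real.sinh_eq]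
    have e1 : Real.exp ((s - s') / 2 * l) * Real.exp ((s + s') / 2 * l) = Real.exp (s * l) := by
      rw [← Real.exp_add]; ring_nf
    have e2 : Real.exp ((s - s') / 2 * l) * Real.exp (-((s + s') / 2 * l)) =
        Real.exp (-(s' * l)) := by
      rw [← Real.exp_add]; ring_nf
    rw [mul_div_assoc', mul_div_assoc', mul_div_assoc', mul_div_assoc', ← add_div]
    congr 1
    linear_combination (-1) * e1 + e2
  have key' := congrArg (fun x : ℝ => Complex.I * (x : ℂ)) key
  rw [hreal, hreal]
  simp only [map_mul, Complex.conj_I, Complex.conj_ofReal, ← Complex.exp_conj, map_neg]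
  push_cast at key' ⊢
  simp only [mul_neg, neg_mul, neg_neg, sub_neg_eq_add] at key' ⊢
  linear_combination key'

end SinhQuot

end

noncomputable section

/-! ### The quotient of top-degree forms -/

section OmegaRatio

variable {n N : ℕ}
  {E : Type*} [NormedAddCommGroup E] [InnerProductSpace ℝ E]
  {K : Type*} [Group K] [TopologicalSpace K] [ChartedSpace E K]

open NormedSpace (exp)

theorem holForm_eq (X : OrthonormalBasis (Fin n) ℝ E) {ρ : K →* unitary (Mat N)}
    (hS : Function.Injective (complexCoord X ρ)) {s : ℝ} {p : K × E} {t : E × E}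
    {c : Fin n → ℂ} (h : psiLogDeriv ρ s p t = complexCoord X ρ c) (k : Fin n) :
    holForm X ρ s p k t = c k := by
  unfold holForm
  rw [h]
  exact congrFun (Function.leftInverse_invFun hS c) k

variable [FiniteDimensional ℝ E] [LieGroup 𝓘(ℝ, E) ∞ K]

theorem psiLogDeriv_fst {ρ : K →* unitary (Mat N)}
    (hρ : ContMDiff 𝓘(ℝ, E) 𝓘(ℝ, Mat N) ∞ fun x : K => (ρ x : Mat N)) (s : ℝ) (x : K) (Y u : E) :
    psiLogDeriv ρ s (x, Y) (u, 0) =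
      exp (-psiExponent K ρ s Y) * repDeriv ρ u * exp (psiExponent K ρ s Y) := by
  rw [psiLogDeriv_eq hρ, map_zero, map_zero, mul_zero, add_zero]

theorem psiLogDeriv_snd {ρ : K →* unitary (Mat N)}
    (hρ : ContMDiff 𝓘(ℝ, E) 𝓘(ℝ, Mat N) ∞ fun x : K => (ρ x : Mat N)) (s : ℝ) (x : K) (Y a : E) :
    psiLogDeriv ρ s (x, Y) (0, a) =
      exp (-psiExponent K ρ s Y) * fderiv ℂ exp (psiExponent K ρ s Y)
        ((Complex.I * (s : ℂ)) • repDeriv ρ a) := by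
  have h0 : repDeriv ρ (0 : E) = 0 := map_zero (repDerivLM (E := E) ρ)
  rw [psiLogDeriv_eq hρ, h0, mul_zero, zero_mul, zero_add]
  rfl

variable (hAd : IsAdInvariant (E := E) K) (X : OrthonormalBasis (Fin n) ℝ E)
  {ρ : K →* unitary (Mat N)} (hinj : Function.Injective ρ)
  (hρ : ContMDiff 𝓘(ℝ, E) 𝓘(ℝ, Mat N) ∞ fun x : K => (ρ x : Mat N))

include hAd hinj hρ in
-- The matrix `A` is chosen before `s`, so the frame matrices for `s` and `s'` are diagonalized by
-- the same eigenvectors.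
theorem exists_frame_matrices (Y : E) :
    ∃ A : Matrix (Fin n) (Fin n) ℂ, A.IsHermitian ∧ A.map (starRingEnd ℂ) = -A ∧ A.trace = 0 ∧
      ∀ s : ℝ, ∃ P Q : Matrix (Fin n) (Fin n) ℂ,
        EigenAction A P (fun l => Complex.exp (-((s * l : ℝ) : ℂ))) ∧
        EigenAction A Q (fun l => Complex.I * s * expQuot ((s * l : ℝ) : ℂ)) ∧
        ∀ (x : K) (j : Fin n),
          psiLogDeriv ρ s (x, Y) (X j, 0) = complexCoord X ρ (P.col j) ∧
          psiLogDeriv ρ s (x, Y) (0, X j) = complexCoord X ρ (Q.col j) := by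
  obtain ⟨A, hA, hconj, htr, hcomm⟩ := exists_hermitian_commutator hAd X hinj hρ Y
  refine ⟨A, hA, hconj, htr, fun s => ?_⟩
  set Z := psiExponent K ρ s Y
  have heig : ∀ (l : ℝ) (v : Fin n → ℂ), A.mulVec v = (l : ℂ) • v →
      Z * complexCoord X ρ v - complexCoord X ρ v * Z = ((s * l : ℝ) : ℂ) • complexCoord X ρ v := by
    intro l v hv
    rw [hcomm, hv, map_smul, Complex.ofReal_mul, mul_smul]
  have hS := complexCoord_injective X hinj hρ
  obtain ⟨P, hP, hP'⟩ := exists_eigenAction hA hS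
    (LinearMap.mulRight ℂ (exp Z) ∘ₗ LinearMap.mulLeft ℂ (exp (-Z)))
    (fun l => Complex.exp (-((s * l : ℝ) : ℂ)))
    (fun l v hv => exp_neg_mul_mul_exp_of_commutator (heig l v hv))
  obtain ⟨Q, hQ, hQ'⟩ := exists_eigenAction hA hS
    (LinearMap.mulLeft ℂ (exp (-Z)) ∘ₗ (fderiv ℂ exp Z : Mat N →ₗ[ℂ] Mat N) ∘ₗ
      ((Complex.I * (s : ℂ)) • LinearMap.id))
    (fun l => Complex.I * s * expQuot ((s * l : ℝ) : ℂ))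
    (fun l v hv => by
      change exp (-Z) * fderiv ℂ exp Z ((Complex.I * (s : ℂ)) • complexCoord X ρ v) = _
      rw [map_smul, mul_smul_comm, exp_neg_mul_fderiv_exp_of_commutator (heig l v hv), smul_smul])
  refine ⟨P, Q, hP, hQ, fun x j => ⟨?_, ?_⟩⟩
  · rw [psiLogDeriv_fst hρ, ← complexCoord_single, ← Matrix.mulVec_single_one, ← hP']
    rfl
  · rw [psiLogDeriv_snd hρ, ← complexCoord_single, ← Matrix.mulVec_single_one, ← hQ']
    rfl

include hAd hinj hρ in
/-- The quotient `(conj Ω_s ∧ Ω_s') / (b ε)` in terms of the eigenvalues of `i ad Y`. -/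
theorem exists_OmegaRatio_eq (Y : E) :
    ∃ l : Fin n → ℝ, ∀ (x : K) (s s' : ℝ),
      OmegaRatio X ρ s s' (x, Y) = ((∏ j, sinhQuot ((s + s') / 2) (l j) : ℝ) : ℂ) := by
  obtain ⟨A, hA, hconj, htr, hframe⟩ := exists_frame_matrices hAd X hinj hρ Y
  have hS := complexCoord_injective X hinj hρ
  refine ⟨hA.eigenvalues, fun x s s' => ?_⟩
  obtain ⟨P, Q, hP, hQ, hPQ⟩ := hframe s
  obtain ⟨P', Q', hP', hQ', hPQ'⟩ := hframe s'
  have hmat : OmegaBarWedgeOmega X ρ s s' (x, Y) (cotangentFrame X) =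
      (Matrix.fromBlocks (P.map (starRingEnd ℂ)) (Q.map (starRingEnd ℂ)) P' Q').det := by
    unfold OmegaBarWedgeOmega wedge
    congr 1
    ext (i | i) (j | j)
    · exact congrArg (starRingEnd ℂ) (holForm_eq X hS (hPQ x j).1 i)
    · exact congrArg (starRingEnd ℂ) (holForm_eq X hS (hPQ x j).2 i)
    · exact holForm_eq X hS (hPQ' x j).1 i
    · exact holForm_eq X hS (hPQ' x j).2 i
  have hsum : ∑ j, hA.eigenvalues j = 0 := by
    have := hA.trace_eq_sum_eigenvalues
    rw [htr] at this
    exact Complex.ofReal_injective (by rw [Complex.ofReal_sum]; exact this.symm)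
  -- Tracelessness removes the only factor that depends on `s - s'`.
  have hexp : ∏ j, Complex.exp (((s - s') / 2 * hA.eigenvalues j : ℝ) : ℂ) = 1 := by
    rw [← Complex.exp_sum, ← Complex.ofReal_sum, ← Finset.mul_sum, hsum]
    simp
  unfold OmegaRatio
  rw [hmat, EigenAction.det_fromBlocks hA (hP.conj hconj) (hQ.conj hconj) hP' hQ'
    (fun l => by simp [Complex.exp_ne_zero]), Finset.prod_congr rfl fun j _ => expQuot_block s s' _,
    Finset.prod_mul_distrib, Finset.prod_mul_distrib (f := fun j => Complex.exp _), hexp, liouvilleForm_cotangentFrame]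
  -- The sign in `b` cancels the value of `ε` on the frame.
  have hone : ((-1 : ℂ) ^ (n * (n - 1) / 2)) * (-1) ^ (n * (n - 1) / 2) = 1 := by
    rw [← mul_pow]; simp
  push_cast
  rw [mul_assoc, hone, Finset.prod_const, Finset.card_univ, Fintype.card_fin]
  have : (2 * Complex.I) ^ n ≠ 0 := pow_ne_zero _ (by simp)
  field_simp

include hAd hinj hρ in
-- The eigenvalues are chosen separately for each `Y`, so continuity is read off the determinant
-- instead, with a linear left inverse of the coordinate map in place of `invFun`.
theorem continuous_OmegaRatio (s s' : ℝ) (x : K) :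
    Continuous fun Y : E => OmegaRatio X ρ s s' (x, Y) := by
  have : NormedAlgebra ℚ (Mat N) := NormedAlgebra.restrictScalars ℚ ℂ (Mat N)
  have hS := complexCoord_injective X hinj hρ
  obtain ⟨L, hL⟩ := (complexCoord X ρ).exists_leftInverse_of_injective (LinearMap.ker_eq_bot.2 hS)
  have hL' : ∀ c, L (complexCoord X ρ c) = c := fun c => congrArg (fun g => g c) hL
  have hLc : Continuous L := L.continuous_of_finiteDimensional
  have hexp : ∀ s, Continuous fun Y : E => exp (psiExponent K ρ s Y) := fun s =>
    NormedSpace.exp_continuous.comp (psiExponent K ρ s).continuous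
  have hexp' : ∀ s, Continuous fun Y : E => exp (-psiExponent K ρ s Y) := fun s =>
    NormedSpace.exp_continuous.comp (psiExponent K ρ s).continuous.neg
  have h1 : ∀ s k j, Continuous fun Y : E => holForm X ρ s (x, Y) k (X j, 0) := by
    intro s k j
    have : ∀ Y : E, holForm X ρ s (x, Y) k (X j, 0) = L (psiLogDeriv ρ s (x, Y) (X j, 0)) k := by
      intro Y
      obtain ⟨A, -, -, -, hframe⟩ := exists_frame_matrices hAd X hinj hρ Y
      obtain ⟨P, Q, -, -, hPQ⟩ := hframe s
      rw [holForm_eq X hS (hPQ x j).1, (hPQ x j).1, hL']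
    simp only [this, psiLogDeriv_fst hρ]
    exact (continuous_apply k).comp (hLc.comp (((hexp' s).mul continuous_const).mul (hexp s)))
  have h2 : ∀ s k j, Continuous fun Y : E => holForm X ρ s (x, Y) k (0, X j) := by
    intro s k j
    have : ∀ Y : E, holForm X ρ s (x, Y) k (0, X j) = L (psiLogDeriv ρ s (x, Y) (0, X j)) k := by
      intro Y
      obtain ⟨A, -, -, -, hframe⟩ := exists_frame_matrices hAd X hinj hρ Y
      obtain ⟨P, Q, -, -, hPQ⟩ := hframe s
      rw [holForm_eq X hS (hPQ x j).2, (hPQ x j).2, hL']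
    simp only [this, psiLogDeriv_snd hρ]
    exact (continuous_apply k).comp (hLc.comp ((hexp' s).mul
      ((continuous_fderiv_normedSpace_exp.comp (psiExponent K ρ s).continuous).clm_apply
        continuous_const)))
  unfold OmegaRatio
  simp only [liouvilleForm_cotangentFrame]
  refine Continuous.div_const ?_ _
  unfold OmegaBarWedgeOmega wedge
  refine Continuous.matrix_det (continuous_matrix fun i j => ?_)
  rcases i with i | i <;> rcases j with j | j
  · exact Complex.continuous_conj.comp (h1 s i j)
  · exact Complex.continuous_conj.comp (h2 s i j)
  · exact h1 s' i j
  · exact h2 s' i j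

include hAd hinj hρ in
theorem OmegaRatio_congr_fst (s s' : ℝ) (x x' : K) (Y : E) :
    OmegaRatio X ρ s s' (x, Y) = OmegaRatio X ρ s s' (x', Y) := by
  obtain ⟨l, hl⟩ := exists_OmegaRatio_eq hAd X hinj hρ Y
  rw [hl, hl]

include hAd hinj hρ in
theorem measurable_OmegaRatio [MeasurableSpace E] [BorelSpace E] [MeasurableSpace K] (s s' : ℝ) :
    Measurable fun p : K × E => OmegaRatio X ρ s s' p := by
  have h : (fun p : K × E => OmegaRatio X ρ s s' p) =
      (fun Y : E => OmegaRatio X ρ s s' ((1 : K), Y)) ∘ Prod.snd := by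
    ext1 ⟨x, Y⟩
    exact OmegaRatio_congr_fst hAd X hinj hρ s s' x 1 Y
  rw [h]
  exact (continuous_OmegaRatio hAd X hinj hρ s s' 1).measurable.comp measurable_snd

end OmegaRatio

end

noncomputable section

/-! ### Uniform second-order estimate of the kernel -/

section KernelBound

/-- Convexity of `sinh` on the half-line, together with `sinh 0 = 0`. -/
theorem sinh_mul_le {t x : ℝ} (ht0 : 0 ≤ t) (ht1 : t ≤ 1) (hx : 0 ≤ x) :
    Real.sinh (t * x) ≤ t * Real.sinh x := by
  have hd : ∀ y, HasDerivAt (fun y => t * Real.sinh y - Real.sinh (t * y))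
      (t * Real.cosh y - Real.cosh (t * y) * t) y := fun y => by
    refine ((Real.hasDerivAt_sinh y).const_mul t).sub ?_
    have := ((hasDerivAt_id y).const_mul t).sinh
    simpa using this
  have hmono : MonotoneOn (fun y => t * Real.sinh y - Real.sinh (t * y)) (Set.Ici 0) := by
    refine monotoneOn_of_deriv_nonneg (convex_Ici 0)
      (fun y _ => (hd y).continuousAt.continuousWithinAt)
      (fun y _ => (hd y).differentiableAt.differentiableWithinAt) fun y hy => ?_
    rw [interior_Ici] at hy
    have hy0 : 0 < y := hy
    rw [(hd y).deriv]
    have h1 : Real.cosh (t * y) ≤ Real.cosh y := by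
      rw [Real.cosh_le_cosh, abs_of_nonneg (by positivity), abs_of_pos hy0]
      nlinarith
    nlinarith
  have := hmono (Set.mem_Ici.2 le_rfl) (Set.mem_Ici.2 hx) hx
  simp only [mul_zero, Real.sinh_zero, sub_zero] at this
  linarith

theorem sinhQuot_neg (r l : ℝ) : sinhQuot r (-l) = sinhQuot r l := by
  unfold sinhQuot
  split_ifs with h h' h'
  · rfl
  · exact absurd (neg_eq_zero.1 h) h'
  · exact absurd (neg_eq_zero.2 h') h
  · rw [mul_neg, Real.sinh_neg, neg_div_neg_eq]

/-- Quantitative logarithmic concavity of `r ↦ sinh (r l) / l`, uniform in `l`. -/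
theorem sinhQuot_midpoint {s s' : ℝ} (hs : 0 < s) (hs' : |s' - s| ≤ s / 2) (l : ℝ) :
    sinhQuot s l * sinhQuot s' l ≤ sinhQuot ((s + s') / 2) l ^ 2 ∧
      sinhQuot ((s + s') / 2) l ^ 2 ≤
        (1 + ((s' - s) / s) ^ 2) * (sinhQuot s l * sinhQuot s' l) := by
  have hs'' : s / 2 ≤ s' := by linarith [(abs_le.1 hs').1]
  wlog hl : 0 ≤ l generalizing l
  · simpa only [sinhQuot_neg] using this (-l) (by linarith)
  unfold sinhQuot
  rcases hl.eq_or_lt with rfl | hl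
  · simp only [if_true]
    constructor
    · nlinarith [sq_nonneg (s - s')]
    · have h1 : ((s + s') / 2) ^ 2 = s * s' + ((s' - s) / s) ^ 2 * (s ^ 2 / 4) := by
        field_simp
        ring
      have h2 : s ^ 2 / 4 ≤ s * s' := by nlinarith
      nlinarith [mul_le_mul_of_nonneg_left h2 (sq_nonneg ((s' - s) / s))]
  · simp only [if_neg hl.ne']
    have hid : Real.sinh ((s + s') / 2 * l) ^ 2 =
        Real.sinh (s * l) * Real.sinh (s' * l) + Real.sinh (|s' - s| * l / 2) ^ 2 := by
      have habs : Real.sinh (|s' - s| * l / 2) ^ 2 = Real.sinh ((s' - s) * l / 2) ^ 2 := by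
        rcases abs_choice (s' - s) with h | h <;> rw [h]
        rw [neg_mul, neg_div, Real.sinh_neg, neg_sq]
      rw [habs]
      have e1 : s * l = (s + s') / 2 * l - (s' - s) * l / 2 := by ring
      have e2 : s' * l = (s + s') / 2 * l + (s' - s) * l / 2 := by ring
      rw [e1, e2, Real.sinh_add, Real.sinh_sub]
      have c1 := Real.cosh_sq ((s + s') / 2 * l)
      have c2 := Real.cosh_sq ((s' - s) * l / 2)
      linear_combination (-Real.sinh ((s + s') / 2 * l) ^ 2) * c2 +
        Real.sinh ((s' - s) * l / 2) ^ 2 * c1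
    -- The error term is `sinh (t x)` with `t = |s' - s| / s` and `x = s l / 2`. This `x` is chosen
    -- because `s / 2` is at most both `s` and `s'`, so `sinh x` is bounded by both factors of the
    -- product.
    have h1 : Real.sinh (|s' - s| * l / 2) ≤ |s' - s| / s * Real.sinh (s / 2 * l) := by
      have := sinh_mul_le (t := |s' - s| / s) (x := s / 2 * l) (by positivity)
        (by rw [div_le_one hs]; linarith) (by positivity)
      convert this using 2
      field_simp
    have h0 : 0 ≤ Real.sinh (|s' - s| * l / 2) := Real.sinh_nonneg_iff.2 (by positivity)
    have h0' : 0 ≤ Real.sinh (s / 2 * l) := Real.sinh_nonneg_iff.2 (by positivity)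
    have h2 : Real.sinh (s / 2 * l) ≤ Real.sinh (s * l) := Real.sinh_le_sinh.2 (by nlinarith)
    have h3 : Real.sinh (s / 2 * l) ≤ Real.sinh (s' * l) := Real.sinh_le_sinh.2 (by nlinarith)
    have h4 : Real.sinh (|s' - s| * l / 2) ^ 2 ≤
        ((s' - s) / s) ^ 2 * (Real.sinh (s * l) * Real.sinh (s' * l)) := by
      calc Real.sinh (|s' - s| * l / 2) ^ 2 ≤ (|s' - s| / s * Real.sinh (s / 2 * l)) ^ 2 :=
            pow_le_pow_left₀ h0 h1 2
        _ = ((s' - s) / s) ^ 2 * (Real.sinh (s / 2 * l) * Real.sinh (s / 2 * l)) := by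
            rw [mul_pow, div_pow, div_pow, sq_abs, sq (Real.sinh _)]
        _ ≤ _ := mul_le_mul_of_nonneg_left (mul_le_mul h2 h3 h0' (h0'.trans h2)) (sq_nonneg _)
    have hprod : Real.sinh (s * l) / l * (Real.sinh (s' * l) / l) =
        Real.sinh (s * l) * Real.sinh (s' * l) / l ^ 2 := by
      field_simp
    rw [hprod, div_pow, hid, ← mul_div_assoc]
    constructor
    · exact div_le_div_of_nonneg_right (by nlinarith [sq_nonneg (Real.sinh (|s' - s| * l / 2))])
        (sq_nonneg l)
    · exact div_le_div_of_nonneg_right (by linarith) (sq_nonneg l)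

/-- The right side is the chord over `[0, 1]` of the convex function `(1 + t)ⁿ`. -/
theorem one_add_pow_le {t : ℝ} (h0 : 0 ≤ t) (h1 : t ≤ 1) (n : ℕ) :
    (1 + t) ^ n ≤ 1 + (2 ^ n - 1) * t := by
  induction n with
  | zero => simp
  | succ n ih =>
    have h2 : (1 : ℝ) ≤ 2 ^ n := one_le_pow₀ (by norm_num)
    calc (1 + t) ^ (n + 1) = (1 + t) ^ n * (1 + t) := pow_succ _ _
      _ ≤ (1 + (2 ^ n - 1) * t) * (1 + t) := by gcongr
      _ ≤ _ := by
        rw [pow_succ]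
        nlinarith [mul_nonneg (sub_nonneg.2 h2) (mul_nonneg h0 (sub_nonneg.2 h1))]

theorem sqrt_sqrt_le {y : ℝ} (hy : 1 ≤ y) : √√y ≤ y := by
  have h : ∀ z : ℝ, 1 ≤ z → √z ≤ z := fun z hz => by
    rw [Real.sqrt_le_left (by linarith)]
    nlinarith
  exact (h _ (Real.one_le_sqrt.2 hy)).trans (h y hy)

/-- The ratio of the kernel of the BKS pairing to the geometric mean of the two norms is one up to
an error of second order, uniformly in `l`. -/
theorem abs_sqrt_prod_sinhQuot_div_sub_one_le {n : ℕ} {s s' : ℝ} (hs : 0 < s)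
    (hs' : |s' - s| ≤ s / 2) (l : Fin n → ℝ) :
    |√(∏ j, sinhQuot ((s + s') / 2) (l j)) /
      (√√(∏ j, sinhQuot s (l j)) * √√(∏ j, sinhQuot s' (l j))) - 1| ≤
      2 ^ n / s ^ 2 * (s' - s) ^ 2 := by
  have hs'' : 0 < s' := by linarith [(abs_le.1 hs').1]
  set a := ∏ j, sinhQuot s (l j)
  set b := ∏ j, sinhQuot s' (l j)
  set m := ∏ j, sinhQuot ((s + s') / 2) (l j)
  have ha : 0 < a := Finset.prod_pos fun j _ => sinhQuot_pos hs _
  have hb : 0 < b := Finset.prod_pos fun j _ => sinhQuot_pos hs'' _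
  have hm : 0 < m := Finset.prod_pos fun j _ => sinhQuot_pos (by linarith) _
  set t := ((s' - s) / s) ^ 2 with ht
  have ht0 : 0 ≤ t := sq_nonneg _
  have ht1 : t ≤ 1 := by
    rw [ht, sq_le_one_iff_abs_le_one, abs_div, abs_of_pos hs, div_le_one hs]
    linarith
  have hlow : a * b ≤ m ^ 2 := by
    rw [← Finset.prod_mul_distrib, ← Finset.prod_pow]
    exact Finset.prod_le_prod
      (fun j _ => (mul_pos (sinhQuot_pos hs _) (sinhQuot_pos hs'' _)).le)
      fun j _ => (sinhQuot_midpoint hs hs' (l j)).1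
  have hupp : m ^ 2 ≤ (1 + t) ^ n * (a * b) := by
    have : (1 + t) ^ n = ∏ _j : Fin n, (1 + t) := by simp
    rw [this, ← Finset.prod_mul_distrib, ← Finset.prod_pow, ← Finset.prod_mul_distrib]
    exact Finset.prod_le_prod (fun j _ => sq_nonneg _)
      fun j _ => (sinhQuot_midpoint hs hs' (l j)).2
  have hw : √√a * √√b = √√(a * b) := by
    rw [Real.sqrt_mul ha.le, Real.sqrt_mul (Real.sqrt_nonneg a)]
  -- The quotient is the fourth root of `m² / (a b)`, which lies between `1` and `(1 + t)ⁿ`.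
  have hmm : √m = √√(m ^ 2) := by rw [Real.sqrt_sq hm.le]
  have hpos : 0 < √√(a * b) := Real.sqrt_pos.2 (Real.sqrt_pos.2 (mul_pos ha hb))
  rw [hw, abs_of_nonneg]
  · rw [sub_le_iff_le_add', div_le_iff₀ hpos, hmm]
    calc √√(m ^ 2) ≤ √√((1 + t) ^ n * (a * b)) :=
          Real.sqrt_le_sqrt (Real.sqrt_le_sqrt hupp)
      _ = √√((1 + t) ^ n) * √√(a * b) := by
          rw [Real.sqrt_mul (by positivity), Real.sqrt_mul (Real.sqrt_nonneg _)]
      _ ≤ (1 + 2 ^ n / s ^ 2 * (s' - s) ^ 2) * √√(a * b) := by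
          refine mul_le_mul_of_nonneg_right ?_ hpos.le
          refine (sqrt_sqrt_le (one_le_pow₀ (by linarith))).trans
            ((one_add_pow_le ht0 ht1 n).trans ?_)
          have : 2 ^ n / s ^ 2 * (s' - s) ^ 2 = 2 ^ n * t := by
            rw [ht, div_pow]; ring
          rw [this]
          linarith
  · rw [sub_nonneg, one_le_div hpos, hmm]
    exact Real.sqrt_le_sqrt (Real.sqrt_le_sqrt hlow)

end KernelBound

/-! ### Weighted `L²` spaces and perturbed inner products -/

section WeightedL2

variable {α : Type*} [MeasurableSpace α] {ν : Measure α} {w : α → ℝ}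

theorem ae_withDensity_ofReal (hw : Measurable w) (hpos : ∀ p, 0 < w p) :
    ae (ν.withDensity fun p => ENNReal.ofReal (w p)) = ae ν := by
  refine le_antisymm (withDensity_absolutelyContinuous ν _).ae_le ?_
  refine (withDensity_absolutelyContinuous' hw.ennreal_ofReal.aemeasurable ?_).ae_le
  exact Filter.Eventually.of_forall fun p => (ENNReal.ofReal_pos.2 (hpos p)).ne'

theorem memLp_two_withDensity_iff (hw : Measurable w) (hpos : ∀ p, 0 < w p) {f : α → ℂ} :
    MemLp f 2 (ν.withDensity fun p => ENNReal.ofReal (w p)) ↔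
      MemLp (fun p => f p * ((√(w p) : ℝ) : ℂ)) 2 ν := by
  have hsq : Measurable fun p => ((√(w p) : ℝ) : ℂ) :=
    Complex.measurable_ofReal.comp hw.sqrt
  have hne : ∀ p, ((√(w p) : ℝ) : ℂ) ≠ 0 := fun p =>
    Complex.ofReal_ne_zero.2 (Real.sqrt_pos.2 (hpos p)).ne'
  have hac : ν ≪ ν.withDensity fun p => ENNReal.ofReal (w p) :=
    withDensity_absolutelyContinuous' hw.ennreal_ofReal.aemeasurable
      (Filter.Eventually.of_forall fun p => (ENNReal.ofReal_pos.2 (hpos p)).ne')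
  have hmeas : AEStronglyMeasurable f (ν.withDensity fun p => ENNReal.ofReal (w p)) ↔
      AEStronglyMeasurable (fun p => f p * ((√(w p) : ℝ) : ℂ)) ν := by
    constructor
    · intro h
      exact (h.mono_ac hac).mul hsq.aestronglyMeasurable
    · intro h
      have h1 := h.mul hsq.inv.aestronglyMeasurable
      refine (h1.congr ?_).mono_ac (withDensity_absolutelyContinuous ν _)
      refine Filter.Eventually.of_forall fun p => ?_
      simp only [Pi.mul_apply, Pi.inv_apply]
      rw [mul_assoc, mul_inv_cancel₀ (hne p), mul_one]
  by_cases h : AEStronglyMeasurable f (ν.withDensity fun p => ENNReal.ofReal (w p))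
  · rw [memLp_two_iff_integrable_sq_norm h, memLp_two_iff_integrable_sq_norm (hmeas.1 h),
      integrable_withDensity_iff_integrable_smul' hw.ennreal_ofReal
        (Filter.Eventually.of_forall fun p => ENNReal.ofReal_lt_top)]
    refine integrable_congr (Filter.Eventually.of_forall fun p => ?_)
    simp only [smul_eq_mul, norm_mul, Complex.norm_real, Real.norm_eq_abs, mul_pow, sq_abs]
    rw [ENNReal.toReal_ofReal (hpos p).le, Real.sq_sqrt (hpos p).le, mul_comm]
  · exact ⟨fun h' => absurd h'.1 h, fun h' => absurd (hmeas.2 h'.1) h⟩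

theorem integral_withDensity_ofReal (hw : Measurable w) (hpos : ∀ p, 0 < w p) (f : α → ℂ) :
    ∫ p, f p ∂(ν.withDensity fun p => ENNReal.ofReal (w p)) = ∫ p, (w p : ℂ) * f p ∂ν := by
  rw [integral_withDensity_eq_integral_toReal_smul hw.ennreal_ofReal
    (Filter.Eventually.of_forall fun p => ENNReal.ofReal_lt_top)]
  refine integral_congr_ae (Filter.Eventually.of_forall fun p => ?_)
  simp only
  rw [ENNReal.toReal_ofReal (hpos p).le, Complex.real_smul]

/-- A bounded perturbation of the kernel of the `L²` inner product. -/
theorem norm_integral_kernel_sub_inner_le (g g' : Lp ℂ 2 ν) {κ : α → ℝ} (hκ : Measurable κ) {c : ℝ}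
    (hc : ∀ p, |κ p - 1| ≤ c) :
    ‖(∫ p, starRingEnd ℂ (g p) * g' p * (κ p : ℂ) ∂ν) - inner ℂ g g'‖ ≤ c * (‖g‖ * ‖g'‖) := by
  have hmeas : AEStronglyMeasurable (fun p => ((κ p - 1 : ℝ) : ℂ) * g' p) ν :=
    (Complex.measurable_ofReal.comp (hκ.sub_const 1)).aestronglyMeasurable.mul
      (Lp.aestronglyMeasurable g')
  have hbound : ∀ p, ‖((κ p - 1 : ℝ) : ℂ) * g' p‖ ≤ c * ‖g' p‖ := fun p => by
    rw [norm_mul, Complex.norm_real, Real.norm_eq_abs]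
    exact mul_le_mul_of_nonneg_right (hc p) (norm_nonneg _)
  -- Splitting `κ g' = g' + (κ - 1) g'` keeps every integral an inner product in `L²`.
  have hL : MemLp (fun p => ((κ p - 1 : ℝ) : ℂ) * g' p) 2 ν :=
    (Lp.memLp g').of_le_mul hmeas (Filter.Eventually.of_forall hbound)
  set h := hL.toLp _
  have hh : ‖h‖ ≤ c * ‖g'‖ := by
    refine Lp.norm_le_mul_norm_of_ae_le_mul ?_
    filter_upwards [hL.coeFn_toLp] with p hp
    rw [hp]
    exact hbound p
  have heq : ∫ p, starRingEnd ℂ (g p) * g' p * (κ p : ℂ) ∂ν = inner ℂ g (g' + h) := by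
    rw [L2.inner_def]
    refine integral_congr_ae ?_
    filter_upwards [hL.coeFn_toLp, Lp.coeFn_add g' h] with p hp hp'
    rw [hp', Pi.add_apply, hp, RCLike.inner_apply]
    push_cast
    ring
  rw [heq, inner_add_right, add_sub_cancel_left]
  calc ‖inner ℂ g h‖ ≤ ‖g‖ * ‖h‖ := norm_inner_le_norm _ _
    _ ≤ ‖g‖ * (c * ‖g'‖) := mul_le_mul_of_nonneg_left hh (norm_nonneg _)
    _ = _ := by ring

theorem hasDerivAt_zero_of_norm_le_sq {F : Type*} [NormedAddCommGroup F] [NormedSpace ℝ F]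
    {f : ℝ → F} {s C : ℝ} (h : ∀ᶠ r in nhds s, ‖f r‖ ≤ C * (r - s) ^ 2) : HasDerivAt f 0 s := by
  have h0 : f s = 0 := by
    have := h.self_of_nhds
    simpa using this
  rw [hasDerivAt_iff_isLittleO]
  simp only [h0, sub_zero, smul_zero]
  have h1 : f =O[nhds s] fun r => (r - s) ^ 2 :=
    Asymptotics.IsBigO.of_bound C (h.mono fun r hr => by
      rwa [Real.norm_of_nonneg (sq_nonneg _)])
  refine h1.trans_isLittleO ?_
  have h2 : (fun r : ℝ => r - s) =o[nhds s] fun _ => (1 : ℝ) := by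
    rw [Asymptotics.isLittleO_one_iff]
    have : Filter.Tendsto (fun r : ℝ => r - s) (nhds s) (nhds (s - s)) :=
      (continuous_id.sub continuous_const).tendsto s
    simpa using this
  simpa [sq] using (Asymptotics.isBigO_refl (fun r : ℝ => r - s) (nhds s)).mul_isLittleO h2

end WeightedL2

end

noncomputable section

/-! ### The BKS pairing in the global trivialization -/

section Connections

variable {n N : ℕ}
  {E : Type*} [NormedAddCommGroup E] [InnerProductSpace ℝ E] [FiniteDimensional ℝ E]
  [MeasurableSpace E] [BorelSpace E]
  {K : Type*} [Group K] [TopologicalSpace K] [ChartedSpace E K] [LieGroup 𝓘(ℝ, E) ∞ K]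
  [MeasurableSpace K]
  (hAd : IsAdInvariant (E := E) K) {X : OrthonormalBasis (Fin n) ℝ E}
  {ρ : K →* unitary (Mat N)} (hinj : Function.Injective ρ)
  (hρ : ContMDiff 𝓘(ℝ, E) 𝓘(ℝ, Mat N) ∞ fun x : K => (ρ x : Mat N))
  {μ : Measure K} {s : ℝ}

include hAd hinj hρ

omit [MeasurableSpace E] [BorelSpace E] [MeasurableSpace K] in
variable (X) in
theorem exists_OmegaRatio_OmegaNorm_eq (p : K × E) :
    ∃ l : Fin n → ℝ, (∀ s s' : ℝ,
      OmegaRatio X ρ s s' p = ((∏ j, sinhQuot ((s + s') / 2) (l j) : ℝ) : ℂ)) ∧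
      ∀ s : ℝ, OmegaNorm X ρ s p = √(∏ j, sinhQuot s (l j)) := by
  obtain ⟨l, hl⟩ := exists_OmegaRatio_eq hAd X hinj hρ p.2
  refine ⟨l, fun s s' => hl p.1 s s', fun s => ?_⟩
  unfold OmegaNorm
  rw [hl p.1 s s, Complex.ofReal_re, add_self_div_two]

omit [MeasurableSpace E] [BorelSpace E] [MeasurableSpace K] in
variable (X) in
theorem OmegaNorm_pos (hs : 0 < s) (p : K × E) : 0 < OmegaNorm X ρ s p := by
  obtain ⟨l, -, hl⟩ := exists_OmegaRatio_OmegaNorm_eq hAd X hinj hρ p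
  rw [hl]
  exact Real.sqrt_pos.2 (Finset.prod_pos fun j _ => sinhQuot_pos hs _)

variable (X) in
theorem measurable_OmegaNorm (s : ℝ) : Measurable fun p : K × E => OmegaNorm X ρ s p :=
  (Complex.measurable_re.comp (measurable_OmegaRatio hAd X hinj hρ s s)).sqrt

/-- For `s > 0` the weight `|Ω_s|` is positive, so the default value `0` in `untrivialize` is never
taken. -/
theorem coeFn_untrivialize (hs : 0 < s) (σ : PrequantumFiber X ρ μ s) :
    untrivialize s σ =ᵐ[liouvilleMeasure X μ] fun p => σ p * ((√(OmegaNorm X ρ s p) : ℝ) : ℂ) := by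
  have h : MemLp (fun p => σ p * ((√(OmegaNorm X ρ s p) : ℝ) : ℂ)) 2 (liouvilleMeasure X μ) :=
    (memLp_two_withDensity_iff (measurable_OmegaNorm hAd X hinj hρ s)
      (OmegaNorm_pos hAd X hinj hρ hs)).1 (Lp.memLp σ)
  unfold untrivialize
  rw [dif_pos h]
  exact h.coeFn_toLp

theorem untrivialize_trivialize (hs : 0 < s) (g : Lp ℂ 2 (liouvilleMeasure X μ)) :
    untrivialize s (trivialize s g : PrequantumFiber X ρ μ s) = g := by
  have hne : ∀ p : K × E, ((√(OmegaNorm X ρ s p) : ℝ) : ℂ) ≠ 0 := fun p =>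
    Complex.ofReal_ne_zero.2 (Real.sqrt_pos.2 (OmegaNorm_pos hAd X hinj hρ hs p)).ne'
  have h : MemLp (fun p => g p / ((√(OmegaNorm X ρ s p) : ℝ) : ℂ)) 2 (fiberMeasure X ρ μ s) := by
    refine (memLp_two_withDensity_iff (measurable_OmegaNorm hAd X hinj hρ s)
      (OmegaNorm_pos hAd X hinj hρ hs)).2 ?_
    simp only [div_mul_cancel₀ _ (hne _)]
    exact Lp.memLp g
  have h1 : (trivialize s g : PrequantumFiber X ρ μ s) =ᵐ[liouvilleMeasure X μ]
      fun p => g p / ((√(OmegaNorm X ρ s p) : ℝ) : ℂ) := by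
    unfold trivialize
    rw [dif_pos h]
    exact (ae_withDensity_ofReal (measurable_OmegaNorm hAd X hinj hρ s)
      (OmegaNorm_pos hAd X hinj hρ hs)).ge h.coeFn_toLp
  refine Lp.ext ?_
  filter_upwards [coeFn_untrivialize hAd hinj hρ hs (trivialize s g), h1] with p hp hp'
  rw [hp, hp', div_mul_cancel₀ _ (hne _)]

theorem inner_eq_inner_untrivialize (hs : 0 < s) (τ σ : PrequantumFiber X ρ μ s) :
    inner ℂ τ σ = inner ℂ (untrivialize s τ) (untrivialize s σ) := by
  rw [L2.inner_def, L2.inner_def]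
  refine (integral_withDensity_ofReal (measurable_OmegaNorm hAd X hinj hρ s)
    (OmegaNorm_pos hAd X hinj hρ hs) _).trans ?_
  refine integral_congr_ae ?_
  filter_upwards [coeFn_untrivialize hAd hinj hρ hs τ, coeFn_untrivialize hAd hinj hρ hs σ]
    with p hτ hσ
  have hsq : ((√(OmegaNorm X ρ s p) : ℝ) : ℂ) * ((√(OmegaNorm X ρ s p) : ℝ) : ℂ) =
      (OmegaNorm X ρ s p : ℂ) := by
    rw [← Complex.ofReal_mul, Real.mul_self_sqrt (OmegaNorm_pos hAd X hinj hρ hs p).le]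
  rw [hτ, hσ, RCLike.inner_apply, RCLike.inner_apply, map_mul, Complex.conj_ofReal, ← hsq]
  ring

/-- In the global trivialization, the BKS pairing is a perturbation of the inner product of second
order in the difference of the parameters. -/
theorem norm_bksPairing_sub_inner_le (hs : 0 < s) {s' : ℝ} (hs' : |s' - s| ≤ s / 2)
    (τ : PrequantumFiber X ρ μ s) (σ' : PrequantumFiber X ρ μ s') :
    ‖bksPairing τ σ' - inner ℂ (untrivialize s τ) (untrivialize s' σ')‖ ≤
      2 ^ n / s ^ 2 * (s' - s) ^ 2 * (‖untrivialize s τ‖ * ‖untrivialize s' σ'‖) := by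
  have hs'' : 0 < s' := by linarith [(abs_le.1 hs').1]
  let κ : K × E → ℝ := fun p => √(OmegaRatio X ρ s s' p).re /
    (√(OmegaNorm X ρ s p) * √(OmegaNorm X ρ s' p))
  have hκ : Measurable κ :=
    (Complex.measurable_re.comp (measurable_OmegaRatio hAd X hinj hρ s s')).sqrt.div
      ((measurable_OmegaNorm hAd X hinj hρ s).sqrt.mul (measurable_OmegaNorm hAd X hinj hρ s').sqrt)
  have hbound : ∀ p, |κ p - 1| ≤ 2 ^ n / s ^ 2 * (s' - s) ^ 2 := fun p => by
    obtain ⟨l, hl, hl'⟩ := exists_OmegaRatio_OmegaNorm_eq hAd X hinj hρ p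
    simp only [κ, hl, hl', Complex.ofReal_re]
    exact abs_sqrt_prod_sinhQuot_div_sub_one_le hs hs' l
  have heq : bksPairing τ σ' = ∫ p, starRingEnd ℂ (untrivialize s τ p) * untrivialize s' σ' p *
      (κ p : ℂ) ∂(liouvilleMeasure X μ) := by
    unfold bksPairing
    refine integral_congr_ae ?_
    filter_upwards [coeFn_untrivialize hAd hinj hρ hs τ, coeFn_untrivialize hAd hinj hρ hs'' σ']
      with p hτ hσ
    obtain ⟨l, hl, hl'⟩ := exists_OmegaRatio_OmegaNorm_eq hAd X hinj hρ p
    have hm : 0 ≤ ∏ j, sinhQuot ((s + s') / 2) (l j) :=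
      (Finset.prod_pos fun j _ => sinhQuot_pos (by linarith) _).le
    -- The quotient is a nonnegative real number, so the principal complex root is the real square
    -- root.
    have hroot : OmegaRatio X ρ s s' p ^ (1 / 2 : ℂ) = ((√(OmegaRatio X ρ s s' p).re : ℝ) : ℂ) := by
      rw [hl, Complex.ofReal_re, Real.sqrt_eq_rpow, Complex.ofReal_cpow hm]
      norm_num
    have h1 : ((√(OmegaNorm X ρ s p) : ℝ) : ℂ) ≠ 0 :=
      Complex.ofReal_ne_zero.2 (Real.sqrt_pos.2 (OmegaNorm_pos hAd X hinj hρ hs p)).ne'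
    have h2 : ((√(OmegaNorm X ρ s' p) : ℝ) : ℂ) ≠ 0 :=
      Complex.ofReal_ne_zero.2 (Real.sqrt_pos.2 (OmegaNorm_pos hAd X hinj hρ hs'' p)).ne'
    rw [hτ, hσ, hroot, map_mul, Complex.conj_ofReal, Complex.ofReal_div, Complex.ofReal_mul]
    field_simp
  rw [heq]
  exact norm_integral_kernel_sub_inner_le _ _ hκ hbound

/-- The pairing is the inner product of the trivialized sections, whose derivative is `⟨τ, δ^prQ
σ⟩`, plus an error of second order with zero derivative. This holds for every `τ` of the prequantum
fiber. -/
theorem hasDerivAt_bksPairing (hs : 0 < s) {σ : ∀ s : ℝ, PrequantumFiber X ρ μ s}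
    (hσ : SectionDifferentiableAt σ s) (τ : PrequantumFiber X ρ μ s) :
    HasDerivAt (fun s' : ℝ => bksPairing τ (σ s')) (inner ℂ τ (prequantumConnection σ s)) s := by
  have hd : HasDerivAt (fun r => untrivialize r (σ r))
      (deriv (fun r => untrivialize r (σ r)) s) s := hσ.hasDerivAt
  have hinner : HasDerivAt (fun r => inner ℂ (untrivialize s τ) (untrivialize r (σ r)))
      (inner ℂ τ (prequantumConnection σ s)) s := by
    have h1 := (hasDerivAt_const s (untrivialize s τ)).inner ℂ hd
    refine h1.congr_deriv ?_
    rw [inner_zero_left, add_zero, inner_eq_inner_untrivialize hAd hinj hρ hs, prequantumConnection,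
      untrivialize_trivialize hAd hinj hρ hs]
  have hrest : HasDerivAt (fun r => bksPairing τ (σ r) -
      inner ℂ (untrivialize s τ) (untrivialize r (σ r))) 0 s := by
    -- The error bound contains the norm of the moving section, which is locally bounded because
    -- differentiability implies continuity.
    obtain ⟨B, hB⟩ : ∃ B : ℝ, ∀ᶠ r in nhds s, ‖untrivialize r (σ r)‖ ≤ B := by
      refine ⟨‖untrivialize s (σ s)‖ + 1, ?_⟩
      exact (hd.continuousAt.norm.eventually (gt_mem_nhds (lt_add_one _))).mono fun r hr => hr.le
    refine hasDerivAt_zero_of_norm_le_sq (C := 2 ^ n / s ^ 2 * (‖untrivialize s τ‖ * B)) ?_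
    have hnear : ∀ᶠ r in nhds s, |r - s| ≤ s / 2 := by
      filter_upwards [Metric.closedBall_mem_nhds s (half_pos hs)] with r hr
      exact hr
    filter_upwards [hB, hnear] with r hr hr'
    refine (norm_bksPairing_sub_inner_le hAd hinj hρ hs hr' τ (σ r)).trans ?_
    calc _ ≤ 2 ^ n / s ^ 2 * (r - s) ^ 2 * (‖untrivialize s τ‖ * B) := by gcongr
      _ = _ := by ring
  refine ((hrest.add hinner).congr_deriv (zero_add _)).congr_of_eventuallyEq
    (Filter.Eventually.of_forall fun r => ?_)
  exact (sub_add_cancel _ _).symm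

end Connections

end

/-! ### Equality of the two connections -/

theorem theorem3p1 {n N : ℕ}
    {E : Type*} [NormedAddCommGroup E] [InnerProductSpace ℝ E] [FiniteDimensional ℝ E]
    [MeasurableSpace E] [BorelSpace E]
    {K : Type*} [Group K] [TopologicalSpace K] [ChartedSpace E K] [LieGroup 𝓘(ℝ, E) ∞ K]
    [T2Space K] [CompactSpace K] [ConnectedSpace K] [MeasurableSpace K] [BorelSpace K]
    (X : OrthonormalBasis (Fin n) ℝ E) (hAd : IsAdInvariant (E := E) K)
    (ρ : K →* unitary (Mat N)) (hρ : Function.Injective ρ)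
    (hρ_smooth : ContMDiff 𝓘(ℝ, E) 𝓘(ℝ, Mat N) ∞ fun x : K => (ρ x : Mat N))
    (μ : Measure K) [μ.IsHaarMeasure]
    (ħ : ℝ) (hħ : 0 < ħ)
    (σ : ∀ s : ℝ, PrequantumFiber X ρ μ s)
    (hσ : ∀ s : ℝ, 0 < s → σ s ∈ quantumFiber X ρ μ ħ s)
    (s : ℝ) (hs : 0 < s) (hσs : SectionDifferentiableAt σ s)
    (D : PrequantumFiber X ρ μ s) :
    IsBKSConnectionValue ħ σ s D ↔ D = quantumConnection ħ σ s := by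
  have hderiv := fun τ => hasDerivAt_bksPairing hAd hρ hρ_smooth hs hσs τ
  constructor
  · rintro ⟨hD, h⟩
    -- Uniqueness of derivatives gives `⟨τ, D⟩ = ⟨τ, δ^prQ σ⟩` for all `τ` in the quantum fiber.
    -- Thus `δ^prQ σ - D` is orthogonal to that fiber, which characterizes the projection.
    refine (Submodule.eq_starProjection_of_mem_of_inner_eq_zero hD fun τ hτ => ?_).symm
    rw [← inner_conj_symm, inner_sub_right, (hderiv τ).unique (h τ hτ), sub_self, map_zero]
  · rintro rfl
    refine ⟨Submodule.starProjection_apply_mem _ _, fun τ hτ => ?_⟩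
    have h0 := Submodule.starProjection_inner_eq_zero (K := quantumFiber X ρ μ ħ s)
      (prequantumConnection σ s) τ hτ
    rw [← inner_conj_symm, map_eq_zero, inner_sub_right, sub_eq_zero] at h0
    have := hderiv τ
    rw [h0] at this
    exact this
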